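/- **Conventions.** A reconfiguration schedule of length $\ell$ (an $\ell$-batch schedule) and cost at most $s$ from a vertex cover $\alpha$ to a vertex cover $\beta$ of a graph $G$ is a sequence $V_0=\alpha,V_1,\dots,V_\ell=\beta$ of vertex covers of $G$ such that for every $0\le i<\ell$ we have $|V_i\cup V_{i+1}|\le s$ and the symmetric difference $V_i\oplus V_{i+1}$ is an independent set of $G$. It is an $(\eta,c)$-approximation if it has cost at most $\eta\max\{|\alpha|,|\beta|\}+c$. The arboricity of a graph is the minimum number of forests needed to cover its edge set. In the (deterministic) LOCAL model on a connected $n$-vertex graph, the nodes have distinct identifiers from a space of size polynomial in $n$ and in each synchronous round every node may send a message of unbounded size to each of its neighbours; local computation is unbounded. Initially a node knows its own identifier, whether it belongs to $\alpha$ and whether it belongs to $\beta$, and the globally known parameters. The nodes compute the schedule $(V_i)_{0\le i\le\ell}$ if in the end every node $v$ knows $\ell$ and, for each $i$, whether $v\in V_i$. **Theorem.** For every $\varepsilon>0$ there is a deterministic LOCAL algorithm such that the following holds. Let $G$ be a connected graph on $n$ vertices with vertex covers $\alpha$ and $\beta$, and let $\lambda\ge 1$ be an integer such that the induced subgraph $G[\alpha\oplus\beta]$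 has arboricity at most $\lambda$, where $n$ and $\lambda$ are known to all nodes. Then the algorithm takes $O(\log^*(n)/\varepsilon)$ rounds and computes an $O\left(\max\{1,\lambda/\varepsilon^2\}\right)$-batch schedule from $\alpha$ to $\beta$ that is a $\left(2-\frac{1}{2\lambda}+\varepsilon,\,1\right)$-approximation. The constant in the bound on the number of batches is absolute, and the one in the bound on the number of rounds depends only on the polynomial that bounds the size of the identifier space. -/

import Mathlib

namespace VCReconf

/-! ### Arboricity and the iterated logarithm -/

/-- The edge set of `G` can be covered by `k` forests, all of them subgraphs of `G`. -/
def CoveredByForests {V : Type*} (G : SimpleGraph V) (k : ℕ) : Prop :=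
  ∃ F : Fin k → SimpleGraph V,
    (∀ i, F i ≤ G ∧ (F i).IsAcyclic) ∧ ∀ u v, G.Adj u v → ∃ i, (F i).Adj u v

/-- The arboricity of `G`: the minimum number of forests needed to cover its edge set
(`⊤` if finitely many do not suffice, which cannot happen for a finite graph). -/
noncomputable def arboricity {V : Type*} (G : SimpleGraph V) : ℕ∞ :=
  ⨅ (k : ℕ) (_ : CoveredByForests G k), (k : ℕ∞)

/-- `log* n`: the least number of times the base-2 logarithm has to be applied, starting from
`n`, until the result is at most 1. -/
noncomputable def logStar (n : ℕ) : ℕ :=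
  sInf {k : ℕ | (Real.logb 2)^[k] (n : ℝ) ≤ 1}

/-! ### Vertex cover reconfiguration schedules -/

section Schedule

variable {V : Type*} [DecidableEq V]

/-- `S 0, …, S ℓ` is a reconfiguration schedule from `α` to `β` in `G` of length `ℓ` and of cost
at most `s`: all `S i` are vertex covers, the union of two consecutive ones has at most `s`
elements, and the symmetric difference of two consecutive ones (a batch) is independent. -/
structure IsSchedule (G : SimpleGraph V) (α β : Finset V) (ℓ : ℕ) (s : ℝ)
    (S : ℕ → Finset V) : Prop where
  isVertexCover : ∀ i ≤ ℓ, G.IsVertexCover (S i : Set V)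
  first : S 0 = α
  last : S ℓ = β
  card_le : ∀ i < ℓ, ((S i ∪ S (i + 1)).card : ℝ) ≤ s
  independent : ∀ i < ℓ, G.IsIndepSet (symmDiff (S i) (S (i + 1)) : Finset V)

/-- `S 0, …, S ℓ` is an `ℓ`-batch schedule from `α` to `β` that is an `(η, c)`-approximation. -/
def IsApproxSchedule (G : SimpleGraph V) (α β : Finset V) (ℓ : ℕ) (η c : ℝ)
    (S : ℕ → Finset V) : Prop :=
  IsSchedule G α β ℓ (η * (max α.card β.card : ℕ) + c) S

end Schedule

/-! ### The LOCAL model -/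

/-- A deterministic algorithm in the LOCAL model. `Known` is the type of the global parameters
that all nodes know, `Input` the type of the private input of a node. Local computation and the
size of states and messages are unbounded.

* `rounds p`: the number of communication rounds, when the global parameters are `p`;
* `init p i x`: the initial state of a node with identifier `i` and input `x`;
* `send s j`: the message that a node in state `s` sends to its neighbour with identifier `j`;
* `recv s R`: the new state of a node in state `s` that has received the messages `R`, where
  `(j, m) ∈ R` means that the neighbour with identifier `j` has sent `m`;
* `output s`: what a node whose final state is `s` outputs. -/
structure LocalAlgorithm (Known Input Output : Type) where
  State : Type
  Msg : Type
  rounds : Known → ℕ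
  init : Known → ℕ → Input → State
  send : State → ℕ → Msg
  recv : State → Set (ℕ × Msg) → State
  output : State → Output

namespace LocalAlgorithm

variable {Known Input Output : Type} {V : Type*}

/-- The state of every node after `t` synchronous rounds on the network `G`. Apart from its own
identifier, its own input and the global parameters, a node has only the messages of its
neighbours to go by. -/
def run (𝒜 : LocalAlgorithm Known Input Output) (G : SimpleGraph V) (p : Known) (ident : V → ℕ)
    (x : V → Input) : ℕ → V → 𝒜.State
  | 0, v => 𝒜.init p (ident v) (x v)
  | t + 1, v => 𝒜.recv (run 𝒜 G p ident x t v)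
      {r | ∃ u, G.Adj v u ∧ r = (ident u, 𝒜.send (run 𝒜 G p ident x t u) (ident v))}

/-- The output of every node after the last round. -/
def result (𝒜 : LocalAlgorithm Known Input Output) (G : SimpleGraph V) (p : Known)
    (ident : V → ℕ) (x : V → Input) (v : V) : Output :=
  𝒜.output (𝒜.run G p ident x (𝒜.rounds p) v)

end LocalAlgorithm

/-- Node `v` outputs a list whose `i`-th entry says whether it belongs to the `i`-th vertex cover;
this is the `i`-th vertex cover given by all these lists. -/
def coverOf {V : Type*} [Fintype V] (out : V → List Bool) (i : ℕ) : Finset V :=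
  Finset.univ.filter fun v => (out v)[i]? = some true

end VCReconf

/-! Write A = α \ β, B = β \ α, k = |α ∩ β|, a = |A|, b = |B| and M = max(|α|, |β|). The set α ∩ β
stays throughout; vertices of B are inserted as soon as some neighbour in A is about to leave.
Complements of vertex covers are independent, so a batch that only touches vertices outside α, or
only vertices outside β, is independent.

For the cost, remove A in order of the number of neighbours in B. A prefix containing a fraction u
of A has at most a fraction u of the edges between A and B, of which there are at most λ(a + b) by
the arboricity bound. So after u·a removals at most min(b, uλ(a + b)) insertions have happened. The
worst u makes the two bounds equal and gives k + a + b - ab/(λ(a + b)), which is at most (2 -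
1/(2λ))M (`step_cost_le`).

A global order is not available locally. Instead the graph is partitioned into connected clusters of
diameter O(1/ε), each containing at least 4/ε vertices of α ∪ β unless there is only one cluster.
Each cluster sorts its own part of A and removes it in T = ⌈2/ε⌉ equal slices. The averaging
argument holds in every cluster with the same fraction, hence in total. Rounding costs at most one
vertex per cluster, that is (ε/2)M, or 1 if there is a single cluster; insertions run one slice
ahead, which costs a/T ≤ (ε/2)M (`isApproxSchedule_inCover`).

The clusters arise from O(log(1/ε)) phases that double the minimum weight (`IsClustering.merge`).
Light clusters point to a neighbouring cluster; Cole–Vishkin colours the pointer graph with 8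
colours in log* n + O(1) steps (`palette_logStar`), and the colours cut it into trees of bounded
depth. Phase costs grow geometrically, so the last one dominates and the total is O(log* n / ε)
rounds. The parameter λ enters only the analysis: the algorithm does not use it. -/

namespace VCReconf

/-! ### Cole–Vishkin colour reduction -/

/-- One Cole–Vishkin step: the position of the lowest bit in which `a` differs from `b`, together
with the value of that bit in `a`. -/
noncomputable def colorStep (a b : ℕ) : ℕ :=
  2 * sInf {i | a.testBit i ≠ b.testBit i} + (a.testBit (sInf {i | a.testBit i ≠ b.testBit i})).toNat

/-- Equal new colours would name one position with one bit value for both `a` and `b`, yet `a` and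
`b` differ at that position. The number `z` is arbitrary: it is the colour that the pointer of `b`
leads to. -/
theorem colorStep_ne {a b : ℕ} (h : a ≠ b) (z : ℕ) : colorStep a b ≠ colorStep b z := by
  intro he
  have hne : {i | a.testBit i ≠ b.testBit i}.Nonempty := by
    by_contra hcon
    rw [Set.not_nonempty_iff_eq_empty] at hcon
    apply h
    apply Nat.eq_of_testBit_eq
    intro i
    by_contra hi
    have : i ∈ {i | a.testBit i ≠ b.testBit i} := hi
    rw [hcon] at this
    exact this
  have hmem := Nat.sInf_mem hne
  unfold colorStep at he
  set i := sInf {i | a.testBit i ≠ b.testBit i} with hi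
  set j := sInf {i | b.testBit i ≠ z.testBit i} with hj
  have h1 := Bool.toNat_le (a.testBit i)
  have h2 := Bool.toNat_le (b.testBit j)
  have hij : i = j := by omega
  rw [← hij] at he
  apply hmem
  have : (a.testBit i).toNat = (b.testBit i).toNat := by omega
  revert this
  cases a.testBit i <;> cases b.testBit i <;> simp

theorem colorStep_lt {a b k : ℕ} (ha : a < 2 ^ k) (hb : b < 2 ^ k) (hk : 0 < k) :
    colorStep a b < 2 * k := by
  unfold colorStep
  set i := sInf {i | a.testBit i ≠ b.testBit i} with hi
  have h1 := Bool.toNat_le (a.testBit i)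
  have hik : i < k := by
    by_cases hne : {i | a.testBit i ≠ b.testBit i}.Nonempty
    · have hmem : a.testBit i ≠ b.testBit i := Nat.sInf_mem hne
      by_contra hcon
      push Not at hcon
      apply hmem
      have : 2 ^ k ≤ 2 ^ i := Nat.pow_le_pow_right (by norm_num) hcon
      rw [Nat.testBit_lt_two_pow (by omega), Nat.testBit_lt_two_pow (by omega)]
    -- If `a = b`, no bit differs and `sInf ∅ = 0`. This is the case of a cluster that points to
    -- itself.
    · rw [Set.not_nonempty_iff_eq_empty] at hne
      rw [hi, hne]
      simpa using hk
  omega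

/-- The size of the palette after `t` colour reduction steps that start with `m` colours. -/
def palette (m : ℕ) : ℕ → ℕ
  | 0 => m
  | t + 1 => 2 * max 1 (Nat.clog 2 (palette m t))

theorem colorStep_lt_palette {m t a b : ℕ} (ha : a < palette m t) (hb : b < palette m t) :
    colorStep a b < palette m (t + 1) := by
  have h := Nat.le_pow_clog (b := 2) (by norm_num) (palette m t)
  have h2 : 2 ^ Nat.clog 2 (palette m t) ≤ 2 ^ max 1 (Nat.clog 2 (palette m t)) :=
    Nat.pow_le_pow_right (by norm_num) (le_max_right _ _)
  exact colorStep_lt (by omega) (by omega) (by omega)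

theorem palette_succ_le {m t k : ℕ} (h : palette m t ≤ 2 ^ k) (hk : 0 < k) :
    palette m (t + 1) ≤ 2 * k := by
  have : Nat.clog 2 (palette m t) ≤ k := Nat.clog_le_of_le_pow h
  simp only [palette]
  omega

theorem palette_add (m s t : ℕ) : palette m (s + t) = palette (palette m s) t := by
  induction t with
  | zero => rfl
  | succ t ih => rw [← add_assoc]; simp only [palette, ih]

theorem two_mul_le_two_pow {d : ℕ} (h : 3 ≤ d) : 2 * d + 2 ≤ 2 ^ d := by
  induction d, h using Nat.le_induction with
  | base => norm_num
  | succ d hd ih => rw [pow_succ]; omega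

theorem palette_succ_lt {m t : ℕ} (h : 8 < palette m t) : palette m (t + 1) < palette m t := by
  have h1 : 2 ^ (Nat.clog 2 (palette m t) - 1) < palette m t := by
    apply Nat.pow_pred_clog_lt_self (by norm_num)
    omega
  have h3 : 3 < Nat.clog 2 (palette m t) := by
    rw [Nat.lt_clog_iff_pow_lt (by norm_num)]
    simpa using h
  have h2 := two_mul_le_two_pow (d := Nat.clog 2 (palette m t) - 1) (by omega)
  simp only [palette]
  omega

/-- Above 8 the palette shrinks strictly, and from at most 8 colours it drops to at most 6. The
bound is crude, but it is only applied to a palette whose size depends on `c` alone. -/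
theorem palette_le_eight {m t : ℕ} (h : m ≤ t + 8) : palette m t ≤ 8 := by
  have key : ∀ s, palette m s ≤ 8 ∨ palette m s + s ≤ m := by
    intro s
    induction s with
    | zero => right; simp [palette]
    | succ s ih =>
      by_cases h8 : palette m s ≤ 8
      · left
        have := palette_succ_le (m := m) (t := s) (k := 3) (by simpa using h8) (by norm_num)
        omega
      · have := palette_succ_lt (m := m) (t := s) (by omega)
        right
        omega
  have := key t
  omega

/-- The power tower of height `k`. -/
def tower : ℕ → ℕ
  | 0 => 1
  | k + 1 => 2 ^ tower k

theorem tower_pos (k : ℕ) : 0 < tower k := by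
  cases k with
  | zero => simp [tower]
  | succ k => simp [tower]

theorem lt_tower (k : ℕ) : k < tower k := by
  induction k with
  | zero => simp [tower]
  | succ k ih =>
    have := Nat.lt_two_pow_self (n := tower k)
    simp only [tower]
    omega

theorem exists_iterate_logb_le (m : ℕ) (y : ℝ) (h : y ≤ tower m) :
    ∃ k, (Real.logb 2)^[k] y ≤ 1 := by
  induction m generalizing y with
  | zero => exact ⟨0, by simpa [tower] using h⟩
  | succ m ih =>
    by_cases hy : y ≤ 1
    · exact ⟨0, hy⟩
    · push Not at hy
      obtain ⟨k, hk⟩ := ih (Real.logb 2 y) (by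
        rw [Real.logb_le_iff_le_rpow (by norm_num) (by linarith), Real.rpow_natCast]
        simpa [tower] using h)
      exact ⟨k + 1, by simpa [Function.iterate_succ_apply] using hk⟩

theorem le_tower_of_iterate_logb_le (k : ℕ) (y : ℝ) (h : (Real.logb 2)^[k] y ≤ 1) :
    y ≤ tower k := by
  induction k generalizing y with
  | zero => simpa [tower] using h
  | succ k ih =>
    have := ih (Real.logb 2 y) (by simpa [Function.iterate_succ_apply] using h)
    by_cases hy : y ≤ 0
    · exact hy.trans (by positivity)
    · rw [Real.logb_le_iff_le_rpow (by norm_num) (by linarith), Real.rpow_natCast] at this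
      simpa [tower] using this

theorem le_tower_logStar (n : ℕ) : n ≤ tower (logStar n) := by
  -- Needed because `sInf ∅ = 0` would be a junk value of `logStar`.
  have hne : {k : ℕ | (Real.logb 2)^[k] (n : ℝ) ≤ 1}.Nonempty :=
    exists_iterate_logb_le n n (by exact_mod_cast (lt_tower n).le)
  exact_mod_cast le_tower_of_iterate_logb_le _ _ (Nat.sInf_mem hne)

theorem logStar_pos {n : ℕ} (h : 2 ≤ n) : 1 ≤ logStar n := by
  by_contra hcon
  have := le_tower_logStar n
  rw [show logStar n = 0 by omega] at this
  simp [tower] at this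
  omega

/-- A step takes 2^(d + x) colours to 2(d + x) ≤ 2^d · x for x ≥ 1, so the tower loses a level while
the factor 2^d absorbs the overhead. -/
theorem palette_le_of_tower {m d k : ℕ} (hd : 3 ≤ d) (h : m ≤ 2 ^ d * tower k) :
    palette m k ≤ 2 ^ d := by
  have key : ∀ j ≤ k, palette m j ≤ 2 ^ d * tower (k - j) := by
    intro j hj
    induction j with
    | zero => simpa [palette] using h
    | succ j ih =>
      have h1 := ih (by omega)
      rw [show k - j = (k - (j + 1)) + 1 by omega, tower, ← pow_add] at h1
      refine (palette_succ_le h1 (by omega)).trans ?_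
      have h2 := two_mul_le_two_pow hd
      have h3 := tower_pos (k - (j + 1))
      nlinarith
  simpa [tower] using key k le_rfl

/-- Identifiers from a space of polynomial size are reduced to `8` colours in
`log* n + O(1)` steps. -/
theorem palette_logStar (n c : ℕ) (hn : 2 ≤ n) :
    palette (n ^ c + c) (logStar n + 2 ^ (c + 3)) ≤ 8 := by
  have hpos := logStar_pos hn
  obtain ⟨k, hk⟩ : ∃ k, logStar n = k + 1 := ⟨logStar n - 1, by omega⟩
  have hnt := le_tower_logStar n
  rw [hk, tower] at hnt
  have ht := tower_pos k
  -- The first step removes the exponent `c`, the next `k` steps take the tower down to 1, and the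
  -- remaining 2^(c + 3) steps lead from 2^(c + 3) colours to 8.
  have h0 : n ^ c + c ≤ 2 ^ (c * tower k + c + 1) := by
    have h1 : n ^ c ≤ 2 ^ (c * tower k) := by
      rw [mul_comm, pow_mul]
      exact Nat.pow_le_pow_left hnt c
    have h2 : c < 2 ^ c := Nat.lt_two_pow_self
    have h3 : 2 ^ (c * tower k) ≤ 2 ^ (c * tower k + c) :=
      Nat.pow_le_pow_right (by norm_num) (by omega)
    have h4 : 2 ^ c ≤ 2 ^ (c * tower k + c) := Nat.pow_le_pow_right (by norm_num) (by omega)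
    rw [pow_succ]
    omega
  have h1 : palette (n ^ c + c) 1 ≤ 2 ^ (c + 3) * tower k := by
    refine (palette_succ_le (t := 0) h0 (by omega)).trans ?_
    have h2 : c < 2 ^ c := Nat.lt_two_pow_self
    rw [pow_add]
    nlinarith [Nat.zero_le (c * tower k)]
  have h2 : palette (n ^ c + c) (1 + k) ≤ 2 ^ (c + 3) := by
    rw [palette_add]
    exact palette_le_of_tower (by omega) h1
  rw [hk, add_comm k 1, palette_add]
  exact palette_le_eight (by omega)

/-! ### One phase of cluster merging -/

section Clustering

variable {V : Type*} (G : SimpleGraph V) (U : Set V) (L : V → ℕ)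

/-- The edges inside the clusters of the labelling `L`. -/
def innerGraph : SimpleGraph V where
  Adj u v := G.Adj u v ∧ L u = L v
  symm := ⟨fun _ _ h => ⟨h.1.symm, h.2.symm⟩⟩
  loopless := ⟨fun _ h => h.1.ne rfl⟩

/-- The number of vertices of `U` in the cluster `x`. -/
noncomputable def weight (x : ℕ) : ℕ := {u | u ∈ U ∧ L u = x}.ncard

/-- The labels of the clusters adjacent to the cluster `x`, and `x` itself. -/
def adjLabels (x : ℕ) : Set ℕ := {y | ∃ u w, L u = x ∧ L w = y ∧ G.Adj u w}

/-- A cluster of weight less than `σ` points to the adjacent cluster with the least label; every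
other cluster points to itself. -/
noncomputable def target (σ x : ℕ) : ℕ :=
  open Classical in
  if weight U L x < σ ∧ (adjLabels G L x \ {x}).Nonempty then sInf (adjLabels G L x \ {x}) else x

/-- The colours of the clusters after `t` Cole–Vishkin steps along `target`. -/
noncomputable def color (σ : ℕ) : ℕ → ℕ → ℕ
  | 0, x => x
  | t + 1, x => colorStep (color σ t x) (color σ t (target G U L σ x))

/-- A cluster follows its pointer if the colour increases along it, or if no cluster joins it along
a pointer with increasing colours. -/
noncomputable def keep (σ t x : ℕ) : ℕ :=
  open Classical in
  if color G U L σ t x < color G U L σ t (target G U L σ x) ∨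
      ∀ y ∈ adjLabels G L x, target G U L σ y = x → color G U L σ t x ≤ color G U L σ t y
  then target G U L σ x else x

/-- The labelling after the merging of clusters. -/
noncomputable def merge (σ t : ℕ) (v : V) : ℕ := (keep G U L σ t)^[16] (L v)

/-- The clusters of `L` are connected and have diameter at most `D`, and they have weight at least
`τ` unless there is only one. -/
structure IsClustering (τ D : ℕ) : Prop where
  reachable : ∀ u v, L u = L v → (innerGraph G L).Reachable u v
  dist_le : ∀ u v, L u = L v → G.dist u v ≤ D
  weight_ge : (∀ v, τ ≤ weight U L (L v)) ∨ ∀ u v, L u = L v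

variable {G U L} {σ t : ℕ}

theorem adjLabels_symm {x y : ℕ} (h : y ∈ adjLabels G L x) : x ∈ adjLabels G L y := by
  obtain ⟨u, w, hu, hw, ha⟩ := h
  exact ⟨w, u, hw, hu, ha.symm⟩

theorem target_eq_self_or (x : ℕ) : target G U L σ x = x ∨
    (target G U L σ x ≠ x ∧ target G U L σ x ∈ adjLabels G L x ∧ weight U L x < σ) := by
  unfold target
  split_ifs with h
  · right
    have := Nat.sInf_mem h.2
    exact ⟨this.2, this.1, h.1⟩
  · left; rfl

theorem target_eq_self {x : ℕ} (h : target G U L σ x = x) :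
    σ ≤ weight U L x ∨ ∀ y ∈ adjLabels G L x, y = x := by
  unfold target at h
  split_ifs at h with hc
  · exact absurd h (Nat.sInf_mem hc.2).2
  · rw [not_and_or] at hc
    rcases hc with hc | hc
    · left; omega
    · right
      intro y hy
      by_contra hne
      exact hc ⟨y, hy, hne⟩

theorem target_mem_range {x : ℕ} (h : x ∈ Set.range L) : target G U L σ x ∈ Set.range L := by
  rcases target_eq_self_or (G := G) (U := U) (L := L) (σ := σ) x with h1 | ⟨_, ⟨u, w, hu, hw, ha⟩, _⟩
  · rwa [h1]
  · exact ⟨w, hw⟩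

theorem color_lt_palette {m x : ℕ} (hm : ∀ v, L v < m) (h : x ∈ Set.range L) :
    color G U L σ t x < palette m t := by
  induction t generalizing x with
  | zero =>
    obtain ⟨v, rfl⟩ := h
    exact hm v
  | succ t ih => exact colorStep_lt_palette (ih h) (ih (target_mem_range h))

theorem color_ne {x : ℕ} (h : target G U L σ x ≠ x) :
    color G U L σ t x ≠ color G U L σ t (target G U L σ x) := by
  induction t with
  | zero => exact h.symm
  | succ t ih => exact colorStep_ne ih _

theorem keep_eq_self_or (x : ℕ) : keep G U L σ t x = x ∨
    (keep G U L σ t x = target G U L σ x ∧ target G U L σ x ≠ x) := by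
  unfold keep
  split_ifs with h
  · by_cases h2 : target G U L σ x = x
    · left; exact h2
    · right; exact ⟨rfl, h2⟩
  · left; rfl

theorem keep_of_color_lt {x : ℕ} (h : color G U L σ t x < color G U L σ t (target G U L σ x)) :
    keep G U L σ t x = target G U L σ x := by
  unfold keep
  rw [if_pos (Or.inl h)]

theorem keep_mem_range {x : ℕ} (h : x ∈ Set.range L) : keep G U L σ t x ∈ Set.range L := by
  rcases keep_eq_self_or (G := G) (U := U) (L := L) (σ := σ) (t := t) x with h1 | ⟨h1, _⟩
  · rwa [h1]
  · rw [h1]; exact target_mem_range h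

/-- A bound on the number of pointers that are followed from the cluster `x`. -/
noncomputable def potential (G : SimpleGraph V) (U : Set V) (L : V → ℕ) (σ t x : ℕ) : ℕ :=
  if color G U L σ t x < color G U L σ t (target G U L σ x) then 7 - color G U L σ t x
  else 8 + color G U L σ t x

theorem potential_lt {x : ℕ} (hx : color G U L σ t x < 8) : potential G U L σ t x < 16 := by
  unfold potential
  split_ifs <;> omega

/-- A cluster entered along an increasing pointer has a cluster joining it in this way, so it can
only follow an increasing pointer itself. Colours along a chain of followed pointers therefore first
fall and then rise. -/
theorem potential_keep {x : ℕ} (hx : color G U L σ t x < 8)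
    (h1 : keep G U L σ t x ≠ x) (h2 : keep G U L σ t (keep G U L σ t x) ≠ keep G U L σ t x)
    (hy : color G U L σ t (keep G U L σ t x) < 8) :
    potential G U L σ t (keep G U L σ t x) < potential G U L σ t x := by
  obtain ⟨h3, h4⟩ := (keep_eq_self_or (G := G) (U := U) (L := L) (σ := σ) (t := t) x).resolve_left h1
  rw [h3] at h2 hy ⊢
  have hne := color_ne (t := t) h4
  have hadj := ((target_eq_self_or (G := G) (U := U) (L := L) (σ := σ) x).resolve_left h4).2.1
  unfold potential
  by_cases hinc : color G U L σ t x < color G U L σ t (target G U L σ x)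
  · have hinc2 : color G U L σ t (target G U L σ x) <
        color G U L σ t (target G U L σ (target G U L σ x)) := by
      by_contra hcon
      apply h2
      unfold keep
      rw [if_neg]
      rintro (h | h)
      · exact hcon h
      · have := h x (adjLabels_symm hadj) rfl
        omega
    rw [if_pos hinc, if_pos hinc2]
    omega
  · rw [if_neg hinc]
    split_ifs <;> omega

/-- With 8 colours the potential starts below 16, so 16 hops exhaust it. -/
theorem keep_iterate_fixed {x : ℕ} (hc : ∀ y ∈ Set.range L, color G U L σ t y < 8)
    (hx : x ∈ Set.range L) :
    keep G U L σ t ((keep G U L σ t)^[16] x) = (keep G U L σ t)^[16] x := by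
  set k := keep G U L σ t with hk
  have hr : ∀ j, k^[j] x ∈ Set.range L := by
    intro j
    induction j with
    | zero => exact hx
    | succ j ih => rw [Function.iterate_succ_apply']; exact keep_mem_range ih
  have key : ∀ j, k (k^[j] x) = k^[j] x ∨ potential G U L σ t (k^[j] x) + j < 16 := by
    intro j
    induction j with
    | zero =>
      right
      exact potential_lt (hc x hx)
    | succ j ih =>
      rw [Function.iterate_succ_apply']
      rcases ih with ih | ih
      · left; rw [ih, ih]
      · by_cases h1 : k (k^[j] x) = k^[j] x
        · left; rw [h1, h1]
        · by_cases h2 : k (k (k^[j] x)) = k (k^[j] x)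
          · left; exact h2
          · right
            have h3 := potential_keep (hc _ (hr j)) h1 h2 (hc _ (keep_mem_range (hr j)))
            rw [← hk] at h3
            omega
  rcases key 16 with h | h
  · exact h
  · omega

/-! ### Distances and weights after merging -/

theorem length_le_of_isPath [DecidableEq V] (hU : G.IsVertexCover U) {u v : V} (p : G.Walk u v)
    (hp : p.IsPath) : p.length ≤ 2 * {w | w ∈ U ∧ w ∈ p.support}.ncard := by
  -- Two edges are peeled off at a time; the first of them has an endpoint in `U`, and its two
  -- entries in the support list are not reused. Only the passage from lists to sets needs a path.
  have hcount : ∀ (w : ℕ) {u v : V} (p : G.Walk u v), p.length ≤ w → p.length ≤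
      2 * (p.support.filter (fun w => open Classical in decide (w ∈ U))).length := by
    intro w
    induction w with
    | zero => intro u v p h; omega
    | succ w ih =>
      intro u v p h
      match p, h with
      | .nil, _ => simp
      | .cons h1 .nil, _ =>
        rcases hU h1 with hu | hu <;> simp only [SimpleGraph.Walk.support_cons,
            SimpleGraph.Walk.support_nil, List.filter_cons, hu, decide_true, if_true] <;>
          split_ifs <;> simp
      | .cons h1 (.cons h2 q), h =>
        have := ih q (by simp at h; omega)
        rcases hU h1 with hu | hu <;> simp only [SimpleGraph.Walk.support_cons,
            SimpleGraph.Walk.length_cons, List.filter_cons, hu, decide_true, if_true] <;>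
          split_ifs <;> simp only [List.length_cons] <;> omega
  refine (hcount _ p le_rfl).trans ?_
  have hnd := hp.support_nodup.filter (fun w => open Classical in decide (w ∈ U))
  rw [← List.toFinset_card_of_nodup hnd, ← Set.ncard_coe_finset]
  apply Nat.mul_le_mul_left
  apply le_of_eq
  congr 1
  ext w
  simp [and_comm]

theorem eq_of_innerGraph_walk {u v : V} (p : (innerGraph G L).Walk u v) :
    ∀ w ∈ p.support, L w = L u := by
  induction p with
  | nil => simp
  | cons h p ih =>
    intro w hw
    rw [SimpleGraph.Walk.support_cons, List.mem_cons] at hw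
    rcases hw with rfl | hw
    · rfl
    · rw [ih w hw, ← h.2]

theorem innerGraph_le : innerGraph G L ≤ G := fun _ _ h => h.1

theorem dist_le_of_innerGraph_reachable [Finite V] (hU : G.IsVertexCover U) {u v : V}
    (h : (innerGraph G L).Reachable u v) : G.dist u v ≤ 2 * weight U L (L u) := by
  classical
  obtain ⟨p, hp⟩ := h.exists_isPath
  have h1 := length_le_of_isPath (U := U) (G := innerGraph G L)
    (fun a b hab => hU (innerGraph_le hab)) p hp
  have h2 : G.dist u v ≤ p.length := by
    have := SimpleGraph.dist_le (p.mapLe innerGraph_le)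
    simpa using this
  refine h2.trans (h1.trans (Nat.mul_le_mul_left _ ?_))
  apply Set.ncard_le_ncard _ (Set.toFinite _)
  rintro w ⟨hw1, hw2⟩
  exact ⟨hw1, eq_of_innerGraph_walk p w hw2⟩

theorem merge_eq_of_label_eq {u v : V} (h : L u = L v) :
    merge G U L σ t u = merge G U L σ t v := by
  unfold merge; rw [h]

theorem innerGraph_le_merge : innerGraph G L ≤ innerGraph G (merge G U L σ t) :=
  fun _ _ h => ⟨h.1, merge_eq_of_label_eq h.2⟩

/-- After 16 hops the iteration is stationary, so starting one hop further ends at the same root. -/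
theorem merge_eq_of_keep (hc : ∀ y ∈ Set.range L, color G U L σ t y < 8) {u v : V}
    (h : L v = keep G U L σ t (L u)) : merge G U L σ t u = merge G U L σ t v := by
  unfold merge
  rw [h, ← Function.iterate_succ_apply (keep G U L σ t) 16 (L u),
    Function.iterate_succ_apply' (keep G U L σ t) 16 (L u), keep_iterate_fixed hc ⟨u, rfl⟩]

/-- Pointers only leave clusters of weight less than `σ`. Since `U` covers all edges, crossing such
a cluster takes at most 2σ steps, and one more edge leads into the target. -/
theorem exists_keep [Finite V] (hU : G.IsVertexCover U) (hG : G.Connected) {τ D : ℕ}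
    (hL : IsClustering G U L τ D)
    (hc : ∀ y ∈ Set.range L, color G U L σ t y < 8) (v : V) :
    ∃ w, L w = keep G U L σ t (L v) ∧ (innerGraph G (merge G U L σ t)).Reachable v w ∧
      G.dist v w ≤ 2 * σ + 1 := by
  rcases keep_eq_self_or (G := G) (U := U) (L := L) (σ := σ) (t := t) (L v) with h | ⟨h, h'⟩
  · exact ⟨v, h.symm, .refl _, by simp⟩
  · obtain ⟨_, ⟨u, w, hu, hw, ha⟩, hwt⟩ := (target_eq_self_or _).resolve_left h'
    have hr := hL.reachable v u hu.symm
    have hw' : L w = keep G U L σ t (L u) := by rw [hw, hu, h]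
    refine ⟨w, by rw [h, hw], (hr.mono innerGraph_le_merge).trans
      (SimpleGraph.Adj.reachable ⟨ha, merge_eq_of_keep hc hw'⟩), ?_⟩
    have h1 := dist_le_of_innerGraph_reachable hU hr
    have h2 := hG.dist_triangle (u := v) (v := u) (w := w)
    have h3 : G.dist u w = 1 := SimpleGraph.dist_eq_one_iff_adj.mpr ha
    omega

theorem exists_root [Finite V] (hU : G.IsVertexCover U) (hG : G.Connected) {τ D : ℕ}
    (hL : IsClustering G U L τ D)
    (hc : ∀ y ∈ Set.range L, color G U L σ t y < 8) (v : V) (j : ℕ) :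
    ∃ w, L w = (keep G U L σ t)^[j] (L v) ∧ (innerGraph G (merge G U L σ t)).Reachable v w ∧
      G.dist v w ≤ j * (2 * σ + 1) := by
  induction j with
  | zero => exact ⟨v, rfl, .refl _, by simp⟩
  | succ j ih =>
    obtain ⟨w, h1, h2, h3⟩ := ih
    obtain ⟨z, h4, h5, h6⟩ := exists_keep hU hG hL hc w
    refine ⟨z, by rw [h4, h1, Function.iterate_succ_apply'], h2.trans h5, ?_⟩
    have := hG.dist_triangle (u := v) (v := w) (w := z)
    rw [add_mul]
    omega

theorem label_const_of_adjLabels (hG : G.Connected) {v : V}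
    (h : ∀ y ∈ adjLabels G L (L v), y = L v) (u : V) : L u = L v := by
  obtain ⟨p⟩ := hG.preconnected v u
  have : ∀ {a b : V} (p : G.Walk a b), L a = L v → L b = L v := by
    intro a b p
    induction p with
    | nil => exact id
    | cons ha p ih => intro h1; exact ih (h _ ⟨_, _, h1, rfl, ha⟩)
  exact this p rfl

/-- Merging doubles the weight of the clusters (or makes it positive), while their diameters grow
by an amount proportional to `σ`. -/
theorem IsClustering.merge [Finite V] (hU : G.IsVertexCover U) (hG : G.Connected) {τ D : ℕ}
    (hL : IsClustering G U L τ D)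
    (hc : ∀ y ∈ Set.range L, color G U L σ t y < 8) (hσ : σ = 1 ∨ σ ≤ 2 * τ) :
    IsClustering G U (merge G U L σ t) σ (D + 64 * σ + 32) := by
  refine ⟨?_, ?_, ?_⟩
  · intro u v huv
    obtain ⟨a, ha1, ha2, -⟩ := exists_root hU hG hL hc u 16
    obtain ⟨b, hb1, hb2, -⟩ := exists_root hU hG hL hc v 16
    have hab : L a = L b := by rw [ha1, hb1]; exact huv
    exact (ha2.trans ((hL.reachable a b hab).mono innerGraph_le_merge)).trans hb2.symm
  -- Both vertices reach the same root cluster within 16 hops, so the distance is at most D + 2 · 16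
  -- · (2σ + 1).
  · intro u v huv
    obtain ⟨a, ha1, -, ha2⟩ := exists_root hU hG hL hc u 16
    obtain ⟨b, hb1, -, hb2⟩ := exists_root hU hG hL hc v 16
    have hab := hL.dist_le a b (by rw [ha1, hb1]; exact huv)
    have h1 := hG.dist_triangle (u := u) (v := a) (w := v)
    have h2 := hG.dist_triangle (u := a) (v := b) (w := v)
    rw [SimpleGraph.dist_comm] at hb2
    omega
  · by_cases hconst : ∀ u v, L u = L v
    · right
      exact fun u v => merge_eq_of_label_eq (hconst u v)
    · left
      have hwt := hL.weight_ge.resolve_right hconst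
      intro v
      obtain ⟨r, hr, -, -⟩ := exists_root hU hG hL hc v 16
      have hfix := keep_iterate_fixed hc ⟨v, rfl⟩
      rw [← hr] at hfix
      have hrv : VCReconf.merge G U L σ t r = VCReconf.merge G U L σ t v := by
        change _ = (keep G U L σ t)^[16] (L v)
        rw [← hr]
        exact Function.iterate_fixed hfix 16
      -- A root that points to itself is heavy, or else it has no adjacent cluster. Any other root
      -- refuses its pointer because some cluster joins it along an increasing pointer, so at least
      -- two old clusters have merged.
      by_cases hf : target G U L σ (L r) = L r
      · rcases target_eq_self hf with h | h
        · refine h.trans (Set.ncard_le_ncard ?_ (Set.toFinite _))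
          rintro w ⟨hw1, hw2⟩
          exact ⟨hw1, by rw [← hrv]; exact merge_eq_of_label_eq hw2⟩
        · have := label_const_of_adjLabels hG h
          exact absurd (fun u v => (this u).trans (this v).symm) hconst
      · have hnot : ¬ (color G U L σ t (L r) < color G U L σ t (target G U L σ (L r)) ∨
            ∀ y ∈ adjLabels G L (L r), target G U L σ y = L r →
              color G U L σ t (L r) ≤ color G U L σ t y) := by
          intro h
          unfold keep at hfix
          rw [if_pos h] at hfix
          exact hf hfix
        push Not at hnot
        obtain ⟨-, y, ⟨a, b, ha, hb, hab⟩, hy, hcol⟩ := hnot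
        have hbr : L r = keep G U L σ t (L b) := by
          rw [keep_of_color_lt, hb, hy]
          rw [hb, hy]
          exact hcol
        have hbv : VCReconf.merge G U L σ t b = VCReconf.merge G U L σ t v :=
          (merge_eq_of_keep hc hbr).trans hrv
        have hav : VCReconf.merge G U L σ t a = VCReconf.merge G U L σ t v :=
          (merge_eq_of_label_eq ha).trans hrv
        -- For `σ = 1` the bound `τ` may be 0, and the weight comes from the edge between the two
        -- merged clusters, which has an endpoint in `U`. Otherwise the two weights of at least `τ`
        -- add up.
        rcases hσ with rfl | hσ
        · have : {u | u ∈ U ∧ VCReconf.merge G U L 1 t u = VCReconf.merge G U L 1 t v}.Nonempty := by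
            rcases hU hab with h | h
            · exact ⟨a, h, hav⟩
            · exact ⟨b, h, hbv⟩
          exact (Set.ncard_pos (Set.toFinite _)).mpr this
        · have hne : L r ≠ L b := by
            intro h
            rw [hb] at h
            rw [h] at hcol
            exact lt_irrefl _ hcol
          have hdisj : Disjoint {u | u ∈ U ∧ L u = L r} {u | u ∈ U ∧ L u = L b} := by
            rw [Set.disjoint_left]
            rintro w ⟨-, h1⟩ ⟨-, h2⟩
            exact hne (h1.symm.trans h2)
          have h1 := hwt r
          have h2 := hwt b
          have h3 := Set.ncard_union_eq hdisj (Set.toFinite _) (Set.toFinite _)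
          have h4 : ({u | u ∈ U ∧ L u = L r} ∪ {u | u ∈ U ∧ L u = L b}).ncard ≤
              weight U (VCReconf.merge G U L σ t) (VCReconf.merge G U L σ t v) := by
            apply Set.ncard_le_ncard _ (Set.toFinite _)
            rintro w (⟨hw1, hw2⟩ | ⟨hw1, hw2⟩)
            · exact ⟨hw1, by rw [← hrv]; exact merge_eq_of_label_eq hw2⟩
            · exact ⟨hw1, by rw [← hbv]; exact merge_eq_of_label_eq hw2⟩
          unfold weight at h1 h2
          omega

theorem merge_mem_range (v : V) : merge G U L σ t v ∈ Set.range L := by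
  have : ∀ j, (keep G U L σ t)^[j] (L v) ∈ Set.range L := by
    intro j
    induction j with
    | zero => exact ⟨v, rfl⟩
    | succ j ih => rw [Function.iterate_succ_apply']; exact keep_mem_range ih
  exact this 16

/-- The labelling after `i` merging phases, starting from singletons. -/
noncomputable def clusters (G : SimpleGraph V) (U : Set V) (ident : V → ℕ) (t : ℕ) : ℕ → V → ℕ
  | 0 => ident
  | i + 1 => merge G U (clusters G U ident t i) (2 ^ i) t

theorem clusters_mem_range (ident : V → ℕ) (i : ℕ) (v : V) :
    clusters G U ident t i v ∈ Set.range ident := by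
  induction i generalizing v with
  | zero => exact ⟨v, rfl⟩
  | succ i ih =>
    obtain ⟨w, hw⟩ := merge_mem_range (G := G) (U := U) (L := clusters G U ident t i)
      (σ := 2 ^ i) (t := t) v
    rw [clusters, ← hw]
    exact ih w

theorem isClustering_clusters [Finite V] (hU : G.IsVertexCover U) (hG : G.Connected)
    {ident : V → ℕ} (hinj : Function.Injective ident) {m : ℕ} (hm : ∀ v, ident v < m)
    (ht : palette m t ≤ 8) (i : ℕ) :
    IsClustering G U (clusters G U ident t i) (2 ^ i / 2) (96 * 2 ^ i) := by
  induction i with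
  | zero =>
    refine ⟨?_, ?_, ?_⟩
    · intro u v h; rw [hinj h]
    · intro u v h; rw [hinj h]; simp
    · left; intro v; simp
  | succ i ih =>
    have h := ih.merge (σ := 2 ^ i) (t := t) hU hG (by
      intro y hy
      refine (color_lt_palette (m := m) ?_ hy).trans_le ht
      intro v
      obtain ⟨w, hw⟩ := clusters_mem_range (G := G) (U := U) (t := t) ident i v
      rw [← hw]; exact hm w) (by
      cases i with
      | zero => left; rfl
      | succ i => right; rw [pow_succ]; omega)
    refine ⟨h.reachable, fun u v huv => (h.dist_le u v huv).trans ?_, ?_⟩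
    -- 96 · 2^i + 64 · 2^i + 32 ≤ 96 · 2^(i + 1).
    · have := Nat.one_le_two_pow (n := i)
      rw [pow_succ]; omega
    · rw [pow_succ, Nat.mul_div_cancel _ (by norm_num)]
      exact h.weight_ge

end Clustering

/-! ### Local functions -/

/-- A connected network on `n` vertices with identifiers below `n ^ c + c`, whose private inputs
describe two vertex covers. -/
structure Network (n c : ℕ) where
  V : Type
  finite : Finite V
  G : SimpleGraph V
  ident : V → ℕ
  input : V → Bool × Bool
  connected : G.Connected
  card : Nat.card V = n
  injective : Function.Injective ident
  ident_lt : ∀ v, ident v < n ^ c + c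
  cover_fst : G.IsVertexCover {v | (input v).1 = true}
  cover_snd : G.IsVertexCover {v | (input v).2 = true}

attribute [instance] Network.finite

/-- What a node can know after `r` rounds. -/
def View : ℕ → Type
  | 0 => ℕ × Bool × Bool
  | r + 1 => View r × Set (ℕ × View r)

/-- What the node `v` knows after `r` rounds in which everyone has told everything. -/
def view {V : Type*} (G : SimpleGraph V) (ident : V → ℕ) (x : V → Bool × Bool) :
    (r : ℕ) → V → View r
  | 0, v => (ident v, x v)
  | r + 1, v => (view G ident x r v, {q | ∃ u, G.Adj v u ∧ q = (ident u, view G ident x r u)})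

/-- The family `F` of functions on the nodes of networks is determined by the `r`-round views. -/
def IsLocal {n c : ℕ} {X : Type*} (r : ℕ) (F : (N : Network n c) → N.V → X) : Prop :=
  ∀ (N N' : Network n c) (v : N.V) (v' : N'.V),
    view N.G N.ident N.input r v = view N'.G N'.ident N'.input r v' → F N v = F N' v'

/-- A family of local functions is computed by an algorithm in the LOCAL model. -/
theorem exists_localAlgorithm {Y : Type} [Inhabited Y] (c : ℕ) (r : ℕ → ℕ)
    (F : (n : ℕ) → (N : Network n c) → N.V → Y) (h : ∀ n, IsLocal (r n) (F n)) :
    ∃ 𝒜 : LocalAlgorithm (ℕ × ℕ) (Bool × Bool) Y, (∀ p, 𝒜.rounds p = r p.1) ∧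
      ∀ n lam (N : Network n c) (v : N.V),
        𝒜.result N.G (n, lam) N.ident N.input v = F n N v := by
  classical
  let 𝒜 : LocalAlgorithm (ℕ × ℕ) (Bool × Bool) Y :=
    { State := ℕ × Σ r, View r
      Msg := ℕ × Σ r, View r
      rounds := fun p => r p.1
      init := fun p i x => (p.1, ⟨0, (i, x)⟩)
      send := fun s _ => s
      recv := fun s R => (s.1, ⟨s.2.1 + 1, (s.2.2, {q | (q.1, (s.1, ⟨s.2.1, q.2⟩)) ∈ R})⟩)
      output := fun s =>
        -- Any network that realises the view may be consulted, since locality makes the answer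
        -- independent of the choice; the actual network shows that one exists.
        if hs : ∃ (N : Network s.1 c) (v : N.V), view N.G N.ident N.input s.2.1 v = s.2.2 then
          F s.1 hs.choose hs.choose_spec.choose
        else default }
  refine ⟨𝒜, fun _ => rfl, fun n lam N v => ?_⟩
  have hrun : ∀ t v, 𝒜.run N.G (n, lam) N.ident N.input t v =
      (n, ⟨t, view N.G N.ident N.input t v⟩) := by
    intro t
    induction t with
    | zero => intro v; rfl
    | succ t ih =>
      intro v
      simp only [LocalAlgorithm.run, ih]
      have : {q : ℕ × View t | ∃ u, N.G.Adj v u ∧ ((q.1, (n, ⟨t, q.2⟩)) : ℕ × ℕ × Σ r, View r) =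
          (N.ident u, (n, ⟨t, view N.G N.ident N.input t u⟩))} =
          {q | ∃ u, N.G.Adj v u ∧ q = (N.ident u, view N.G N.ident N.input t u)} := by
        ext q
        simp [Prod.ext_iff]
      change (n, (⟨t + 1, (_, {q : ℕ × View t | ∃ u, N.G.Adj v u ∧
        ((q.1, (n, ⟨t, q.2⟩)) : ℕ × ℕ × Σ r, View r) =
          (N.ident u, (n, ⟨t, view N.G N.ident N.input t u⟩))})⟩ : Σ r, View r)) = _
      rw [this]
      rfl
  have hs : ∃ (N' : Network n c) (v' : N'.V),
      view N'.G N'.ident N'.input (r n) v' = view N.G N.ident N.input (r n) v := ⟨N, v, rfl⟩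
  have hres : 𝒜.result N.G (n, lam) N.ident N.input v =
      𝒜.output (n, ⟨r n, view N.G N.ident N.input (r n) v⟩) := by
    unfold LocalAlgorithm.result
    rw [hrun]
  rw [hres]
  change dite _ _ _ = _
  rw [dif_pos hs]
  exact h n _ _ _ _ hs.choose_spec.choose_spec

namespace IsLocal

variable {n c : ℕ} {X Y : Type*} {r : ℕ}

theorem mono {F : (N : Network n c) → N.V → X} (h : IsLocal r F) {s : ℕ} (hrs : r ≤ s) :
    IsLocal s F := by
  induction s, hrs using Nat.le_induction with
  | base => exact h
  | succ s _ ih => exact fun N N' v v' hv => ih N N' v v' (congrArg Prod.fst hv)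

theorem map {F : (N : Network n c) → N.V → X} (h : IsLocal r F) (g : X → Y) :
    IsLocal r (fun N v => g (F N v)) :=
  fun N N' v v' hv => congrArg g (h N N' v v' hv)

theorem prodMk {F : (N : Network n c) → N.V → X} {F' : (N : Network n c) → N.V → Y}
    (h : IsLocal r F) (h' : IsLocal r F') : IsLocal r (fun N v => (F N v, F' N v)) :=
  fun N N' v v' hv => Prod.ext (h N N' v v' hv) (h' N N' v v' hv)

theorem ident : IsLocal (n := n) (c := c) r (fun N v => N.ident v) :=
  mono (r := 0) (fun _ _ _ _ hv => congrArg Prod.fst hv) (Nat.zero_le r)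

theorem input : IsLocal (n := n) (c := c) r (fun N v => N.input v) :=
  mono (r := 0) (fun _ _ _ _ hv => congrArg Prod.snd hv) (Nat.zero_le r)

theorem neighbors {F : (N : Network n c) → N.V → X} (h : IsLocal r F) :
    IsLocal (r + 1) (fun N v => {q | ∃ u, N.G.Adj v u ∧ q = F N u}) := by
  have key : ∀ (N N' : Network n c) (v : N.V) (v' : N'.V),
      view N.G N.ident N.input (r + 1) v = view N'.G N'.ident N'.input (r + 1) v' →
      ∀ q, (∃ u, N.G.Adj v u ∧ q = F N u) → ∃ u, N'.G.Adj v' u ∧ q = F N' u := by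
    rintro N N' v v' hv q ⟨u, hu, rfl⟩
    have h2 := congrArg Prod.snd hv
    have h3 : (N.ident u, view N.G N.ident N.input r u) ∈
        (view N.G N.ident N.input (r + 1) v).2 := ⟨u, hu, rfl⟩
    rw [h2] at h3
    obtain ⟨u', hu', he⟩ := h3
    exact ⟨u', hu', h _ _ _ _ (congrArg Prod.snd he)⟩
  intro N N' v v' hv
  ext q
  exact ⟨key N N' v v' hv q, key N' N v' v hv.symm q⟩

theorem ball {F : (N : Network n c) → N.V → X} (h : IsLocal r F) (s : ℕ) :
    IsLocal (r + s) (fun N v => {q | ∃ u, N.G.dist v u ≤ s ∧ q = F N u}) := by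
  induction s with
  | zero =>
    have : (fun (N : Network n c) (v : N.V) => {q | ∃ u, N.G.dist v u ≤ 0 ∧ q = F N u}) =
        fun N v => {F N v} := by
      funext N v
      ext q
      simp [N.connected.dist_eq_zero_iff]
    rw [this]
    exact h.map _
  | succ s ih =>
    have : (fun (N : Network n c) (v : N.V) => {q | ∃ u, N.G.dist v u ≤ s + 1 ∧ q = F N u}) =
        fun N v => {q | ∃ u, N.G.dist v u ≤ s ∧ q = F N u} ∪
          ⋃₀ {Q | ∃ w, N.G.Adj v w ∧ Q = {q | ∃ u, N.G.dist w u ≤ s ∧ q = F N u}} := by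
      funext N v
      ext q
      constructor
      · rintro ⟨u, hu, rfl⟩
        obtain ⟨p, hp⟩ := N.connected.exists_walk_length_eq_dist v u
        cases p with
        | nil => left; exact ⟨v, by simp, rfl⟩
        | cons ha p =>
          right
          refine ⟨_, ⟨_, ha, rfl⟩, u, ?_, rfl⟩
          have := SimpleGraph.dist_le p
          rw [SimpleGraph.Walk.length_cons] at hp
          omega
      · rintro (⟨u, hu, rfl⟩ | ⟨_, ⟨w, hw, rfl⟩, u, hu, rfl⟩)
        · exact ⟨u, by omega, rfl⟩
        · refine ⟨u, ?_, rfl⟩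
          have h1 := N.connected.dist_triangle (u := v) (v := w) (w := u)
          have h2 : N.G.dist v w = 1 := SimpleGraph.dist_eq_one_iff_adj.mpr hw
          omega
    rw [this]
    exact ((ih.mono (Nat.le_succ _)).prodMk ih.neighbors).map (fun q => q.1 ∪ ⋃₀ q.2)

/-! ### Locality of the clustering -/

section Cluster

variable {L : (N : Network n c) → N.V → ℕ} {D : ℕ}

theorem cluster {F : (N : Network n c) → N.V → X} (hL : IsLocal r L) (hF : IsLocal r F)
    (hD : ∀ (N : Network n c) (u v : N.V), L N u = L N v → N.G.dist u v ≤ D) :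
    IsLocal (r + D) (fun N v => {q | ∃ u, L N u = L N v ∧ q = F N u}) := by
  have : (fun (N : Network n c) (v : N.V) => {q | ∃ u, L N u = L N v ∧ q = F N u}) =
      fun N v => {q | (L N v, q) ∈ {q | ∃ u, N.G.dist v u ≤ D ∧ q = (L N u, F N u)}} := by
    funext N v
    ext q
    constructor
    · rintro ⟨u, hu, rfl⟩
      exact ⟨u, hD N v u hu.symm, by rw [hu]⟩
    · rintro ⟨u, _, hq⟩
      exact ⟨u, (congrArg Prod.fst hq).symm, congrArg Prod.snd hq⟩
  rw [this]
  exact ((hL.mono (Nat.le_add_right _ _)).prodMk ((hL.prodMk hF).ball D)).map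
    (fun q => {z | (q.1, z) ∈ q.2})

theorem adjValues {Φ : (N : Network n c) → ℕ → X} (hL : IsLocal r L)
    (hΦ : IsLocal r (fun N v => Φ N (L N v)))
    (hD : ∀ (N : Network n c) (u v : N.V), L N u = L N v → N.G.dist u v ≤ D) :
    IsLocal (r + (D + 1))
      (fun N v => {q | ∃ y ∈ adjLabels N.G (L N) (L N v), q = (y, Φ N y)}) := by
  have : (fun (N : Network n c) (v : N.V) =>
      {q : ℕ × X | ∃ y ∈ adjLabels N.G (L N) (L N v), q = (y, Φ N y)}) =
      fun N v => ⋃₀ {Q | ∃ u, L N u = L N v ∧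
        Q = {q | ∃ w, N.G.Adj u w ∧ q = (L N w, Φ N (L N w))}} := by
    funext N v
    ext q
    constructor
    · rintro ⟨_, ⟨u, w, hu, rfl, ha⟩, rfl⟩
      exact ⟨_, ⟨u, hu, rfl⟩, w, ha, rfl⟩
    · rintro ⟨_, ⟨u, hu, rfl⟩, w, ha, rfl⟩
      exact ⟨_, ⟨u, w, hu, rfl, ha⟩, rfl⟩
  rw [this, show r + (D + 1) = r + 1 + D by ring]
  exact ((hL.mono (Nat.le_succ _)).cluster (hL.prodMk hΦ).neighbors hD).map Set.sUnion

/-- One hop along a pointer: the values of all adjacent clusters are collected together with their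
labels, and the label `g N (L N v)` selects the right one. -/
theorem comp_label {Φ : (N : Network n c) → ℕ → X} {g : (N : Network n c) → ℕ → ℕ}
    (hL : IsLocal r L) (hΦ : IsLocal r (fun N v => Φ N (L N v)))
    (hg : IsLocal r (fun N v => g N (L N v)))
    (hadj : ∀ (N : Network n c) x, g N x = x ∨ g N x ∈ adjLabels N.G (L N) x)
    (hD : ∀ (N : Network n c) (u v : N.V), L N u = L N v → N.G.dist u v ≤ D) :
    IsLocal (r + (D + 1)) (fun N v => Φ N (g N (L N v))) := by
  intro N N' v v' hv
  have h1 := (hL.adjValues hΦ hD) N N' v v' hv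
  have h2 := hg.mono (Nat.le_add_right r (D + 1)) N N' v v' hv
  have h3 := hΦ.mono (Nat.le_add_right r (D + 1)) N N' v v' hv
  have h4 := hL.mono (Nat.le_add_right r (D + 1)) N N' v v' hv
  dsimp only at h1 h2 h3 ⊢
  rcases hadj N (L N v) with h | h
  · have : g N' (L N' v') = L N' v' := by rw [← h2, h, h4]
    rw [h, this, h3]
  · have h5 : (g N (L N v), Φ N (g N (L N v))) ∈
        {q | ∃ y ∈ adjLabels N.G (L N) (L N v), q = (y, Φ N y)} := ⟨_, h, rfl⟩
    rw [h1] at h5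
    obtain ⟨y, -, hy⟩ := h5
    rw [Prod.ext_iff] at hy
    dsimp only at hy
    rw [hy.2, ← h2, hy.1]

/-- The vertices in the first or the second vertex cover. -/
def _root_.VCReconf.unionSet {V : Type*} (x : V → Bool × Bool) : Set V :=
  {v | (x v).1 = true ∨ (x v).2 = true}

theorem cluster_ncard {F : (N : Network n c) → N.V → X} (hL : IsLocal r L) (hF : IsLocal r F)
    (hD : ∀ (N : Network n c) (u v : N.V), L N u = L N v → N.G.dist u v ≤ D)
    (P : X → X → Prop) :
    IsLocal (r + D) (fun N v => {u | L N u = L N v ∧ P (F N u) (F N v)}.ncard) := by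
  have : (fun (N : Network n c) (v : N.V) => {u | L N u = L N v ∧ P (F N u) (F N v)}.ncard) =
      fun N v => (Prod.fst '' {q : ℕ × X | P q.2 (F N v) ∧
        q ∈ {q | ∃ u, L N u = L N v ∧ q = (N.ident u, F N u)}}).ncard := by
    funext N v
    -- Views contain identifiers rather than vertices, so the identifiers are counted.
    rw [← Set.ncard_image_of_injective _ N.injective]
    congr 1
    ext i
    constructor
    · rintro ⟨u, ⟨hu1, hu2⟩, rfl⟩
      exact ⟨(N.ident u, F N u), ⟨hu2, u, hu1, rfl⟩, rfl⟩
    · rintro ⟨_, ⟨hu1, u, hu2, rfl⟩, rfl⟩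
      exact ⟨u, ⟨hu2, hu1⟩, rfl⟩
  rw [this]
  exact ((hL.cluster (ident.prodMk hF) hD).prodMk (hF.mono (Nat.le_add_right _ _))).map
    (fun S => (Prod.fst '' {q : ℕ × X | P q.2 S.2 ∧ q ∈ S.1}).ncard)

theorem weight (hL : IsLocal r L)
    (hD : ∀ (N : Network n c) (u v : N.V), L N u = L N v → N.G.dist u v ≤ D) :
    IsLocal (r + D) (fun N v => VCReconf.weight (unionSet N.input) (L N) (L N v)) := by
  unfold VCReconf.weight
  simp_rw [and_comm]
  exact hL.cluster_ncard input hD (fun x _ => x.1 = true ∨ x.2 = true)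

theorem target (hL : IsLocal r L)
    (hD : ∀ (N : Network n c) (u v : N.V), L N u = L N v → N.G.dist u v ≤ D) (σ : ℕ) :
    IsLocal (r + (D + 1))
      (fun N v => VCReconf.target N.G (unionSet N.input) (L N) σ (L N v)) := by
  intro N N' v v' hv
  have h1 := (hL.adjValues (Φ := fun _ _ => ()) (fun _ _ _ _ _ => rfl) hD) N N' v v' hv
  have h2 := (hL.weight hD).mono (by omega) N N' v v' hv
  have h3 := hL.mono (Nat.le_add_right r (D + 1)) N N' v v' hv
  have h4 : adjLabels N.G (L N) (L N v) = adjLabels N'.G (L N') (L N' v') := by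
    ext y
    have := Set.ext_iff.mp h1 (y, ())
    simpa using this
  dsimp only at h2 ⊢
  unfold VCReconf.target
  rw [h2, h4, h3]

theorem color (hL : IsLocal r L)
    (hD : ∀ (N : Network n c) (u v : N.V), L N u = L N v → N.G.dist u v ≤ D) (σ t : ℕ) :
    IsLocal (r + (t + 1) * (D + 1))
      (fun N v => VCReconf.color N.G (unionSet N.input) (L N) σ t (L N v)) := by
  induction t with
  | zero => exact hL.mono (Nat.le_add_right _ _)
  | succ t ih =>
    have h1 := (hL.mono (Nat.le_add_right r ((t + 1) * (D + 1)))).comp_label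
      (Φ := fun N => VCReconf.color N.G (unionSet N.input) (L N) σ t)
      (g := fun N => VCReconf.target N.G (unionSet N.input) (L N) σ) ih
      ((hL.target hD σ).mono (by rw [add_mul]; omega))
      (fun N x => (target_eq_self_or x).imp_right fun h => h.2.1) hD
    rw [show r + (t + 1 + 1) * (D + 1) = r + (t + 1) * (D + 1) + (D + 1) by ring]
    exact ((ih.mono (Nat.le_add_right _ _)).prodMk h1).map (fun q => colorStep q.1 q.2)

theorem keep (hL : IsLocal r L)
    (hD : ∀ (N : Network n c) (u v : N.V), L N u = L N v → N.G.dist u v ≤ D) (σ t : ℕ) :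
    IsLocal (r + (t + 2) * (D + 1))
      (fun N v => VCReconf.keep N.G (unionSet N.input) (L N) σ t (L N v)) := by
  have e : r + (t + 2) * (D + 1) = r + (t + 1) * (D + 1) + (D + 1) := by ring
  rw [e]
  have hL' := hL.mono (Nat.le_add_right r ((t + 1) * (D + 1)))
  have hcol := hL.color hD σ t
  have htar : IsLocal (r + (t + 1) * (D + 1))
      (fun N v => VCReconf.target N.G (unionSet N.input) (L N) σ (L N v)) :=
    (hL.target hD σ).mono (by rw [add_mul]; omega)
  have h1 := hL'.comp_label
      (Φ := fun N => VCReconf.color N.G (unionSet N.input) (L N) σ t)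
      (g := fun N => VCReconf.target N.G (unionSet N.input) (L N) σ) hcol htar
      (fun N x => (target_eq_self_or x).imp_right fun h => h.2.1) hD
  have h2 := hL'.adjValues
    (Φ := fun N x => (VCReconf.target N.G (unionSet N.input) (L N) σ x,
      VCReconf.color N.G (unionSet N.input) (L N) σ t x)) (htar.prodMk hcol) hD
  intro N N' v v' hv
  have h1 := h1 N N' v v' hv
  have h2 := h2 N N' v v' hv
  have h3 := hL'.mono (Nat.le_add_right _ (D + 1)) N N' v v' hv
  have h4 := hcol.mono (Nat.le_add_right _ (D + 1)) N N' v v' hv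
  have h5 := htar.mono (Nat.le_add_right _ (D + 1)) N N' v v' hv
  dsimp only at h1 h2 h4 h5 ⊢
  have key : ∀ (N N' : Network n c) (v : N.V) (v' : N'.V), L N v = L N' v' →
      VCReconf.color N.G (unionSet N.input) (L N) σ t (L N v) =
        VCReconf.color N'.G (unionSet N'.input) (L N') σ t (L N' v') →
      {q | ∃ y ∈ adjLabels N.G (L N) (L N v), q =
        (y, VCReconf.target N.G (unionSet N.input) (L N) σ y,
          VCReconf.color N.G (unionSet N.input) (L N) σ t y)} =
      {q | ∃ y ∈ adjLabels N'.G (L N') (L N' v'), q =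
        (y, VCReconf.target N'.G (unionSet N'.input) (L N') σ y,
          VCReconf.color N'.G (unionSet N'.input) (L N') σ t y)} →
      (∀ y ∈ adjLabels N.G (L N) (L N v),
        VCReconf.target N.G (unionSet N.input) (L N) σ y = L N v →
        VCReconf.color N.G (unionSet N.input) (L N) σ t (L N v) ≤
          VCReconf.color N.G (unionSet N.input) (L N) σ t y) →
      ∀ y ∈ adjLabels N'.G (L N') (L N' v'),
        VCReconf.target N'.G (unionSet N'.input) (L N') σ y = L N' v' →
        VCReconf.color N'.G (unionSet N'.input) (L N') σ t (L N' v') ≤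
          VCReconf.color N'.G (unionSet N'.input) (L N') σ t y := by
    intro N N' v v' h3 h4 h2 H y hy hty
    have h6 : (y, VCReconf.target N'.G (unionSet N'.input) (L N') σ y,
          VCReconf.color N'.G (unionSet N'.input) (L N') σ t y) ∈
        {q | ∃ y ∈ adjLabels N'.G (L N') (L N' v'), q =
          (y, VCReconf.target N'.G (unionSet N'.input) (L N') σ y,
            VCReconf.color N'.G (unionSet N'.input) (L N') σ t y)} := ⟨y, hy, rfl⟩
    rw [← h2] at h6
    obtain ⟨z, hz, he⟩ := h6
    simp only [Prod.mk.injEq] at he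
    obtain ⟨rfl, he1, he2⟩ := he
    rw [← h4, he2]
    exact H y hz (by rw [← he1, hty, h3])
  have hiff := Iff.intro (key N N' v v' h3 h4 h2) (key N' N v' v h3.symm h4.symm h2.symm)
  unfold VCReconf.keep
  classical
  exact if_congr (or_congr (by rw [h1, h4]) hiff) h5 h3

theorem merge (hL : IsLocal r L)
    (hD : ∀ (N : Network n c) (u v : N.V), L N u = L N v → N.G.dist u v ≤ D) (σ t : ℕ) :
    IsLocal (r + (t + 18) * (D + 1))
      (fun N v => VCReconf.merge N.G (unionSet N.input) (L N) σ t v) := by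
  -- It takes t + 2 cluster traversals to know `keep` and one more for each of the 16 hops.
  have key : ∀ j, IsLocal (r + (t + 2 + j) * (D + 1)) (fun N v =>
      (VCReconf.keep N.G (unionSet N.input) (L N) σ t)^[j] (L N v)) := by
    intro j
    induction j with
    | zero => exact hL.mono (Nat.le_add_right _ _)
    | succ j ih =>
      rw [show r + (t + 2 + (j + 1)) * (D + 1) = r + (t + 2 + j) * (D + 1) + (D + 1) by ring]
      refine (hL.mono (Nat.le_add_right _ _)).comp_label
        (Φ := fun N => (VCReconf.keep N.G (unionSet N.input) (L N) σ t)^[j])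
        (g := fun N => VCReconf.keep N.G (unionSet N.input) (L N) σ t) ih
        ((hL.keep hD σ t).mono (Nat.add_le_add_left (Nat.mul_le_mul_right _ (by omega)) _))
        (fun N x => ?_) hD
      rcases keep_eq_self_or (G := N.G) (U := unionSet N.input) (L := L N) (σ := σ) (t := t) x
        with h | ⟨h, h'⟩
      · exact Or.inl h
      · right
        rw [h]
        exact ((target_eq_self_or x).resolve_left h').2.1
  exact key 16

end Cluster

theorem _root_.VCReconf.Network.cover_unionSet (N : Network n c) :
    N.G.IsVertexCover (unionSet N.input) :=
  fun _ _ h => (N.cover_fst h).imp Or.inl Or.inl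

theorem clusters {t : ℕ} (ht : palette (n ^ c + c) t ≤ 8) (i : ℕ) :
    IsLocal (n := n) (c := c) ((t + 18) * 97 * 2 ^ i)
      (fun N v => VCReconf.clusters N.G (unionSet N.input) N.ident t i v) := by
  induction i with
  | zero => exact ident
  | succ i ih =>
    refine (ih.merge (fun N => (isClustering_clusters N.cover_unionSet N.connected N.injective
      N.ident_lt ht i).dist_le) (2 ^ i) t).mono ?_
    -- As 96 · 2^i + 1 ≤ 97 · 2^i, a phase costs at most the radius accumulated so far, which at
    -- most doubles.
    have := Nat.one_le_two_pow (n := i)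
    rw [pow_succ]
    nlinarith [Nat.zero_le t, Nat.mul_le_mul_left t this]

end IsLocal

/-! ### Arboricity -/

theorem ncard_edgeSet_le_of_isAcyclic {W : Type*} [Finite W] {F : SimpleGraph W}
    (hF : F.IsAcyclic) : F.edgeSet.ncard ≤ Nat.card W := by
  classical
  have := Fintype.ofFinite W
  cases isEmpty_or_nonempty W with
  | inl h =>
    have : F.edgeSet = ∅ := by
      ext e
      induction e with
      | _ u v => exact h.elim u
    simp [this]
  | inr h =>
    obtain ⟨T, hFT, -, hT⟩ := SimpleGraph.Connected.exists_isTree_le_of_le_of_isAcyclic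
      (G := (⊤ : SimpleGraph W)) SimpleGraph.connected_top le_top hF
    have h1 := hT.card_edgeFinset
    have h2 := Set.ncard_le_ncard (SimpleGraph.edgeSet_mono hFT) (Set.toFinite _)
    rw [← SimpleGraph.coe_edgeFinset T, Set.ncard_coe_finset] at h2
    rw [Nat.card_eq_fintype_card]
    omega

theorem exists_coveredByForests {W : Type*} {H : SimpleGraph W} {lam : ℕ}
    (h : arboricity H ≤ lam) : ∃ k ≤ lam, CoveredByForests H k := by
  by_contra hcon
  push Not at hcon
  have : ((lam + 1 : ℕ) : ℕ∞) ≤ arboricity H := by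
    refine le_iInf₂ fun k hk => ?_
    by_contra hlt
    push Not at hlt
    exact hcon k (by have := ENat.natCast_lt_natCast.mp hlt; omega) hk
  have h2 := ENat.natCast_le_natCast.mp (this.trans h)
  omega

theorem ncard_edgeSet_le_of_arboricity {W : Type*} [Finite W] {H : SimpleGraph W} {lam : ℕ}
    (h : arboricity H ≤ lam) : H.edgeSet.ncard ≤ lam * Nat.card W := by
  classical
  obtain ⟨k, hk, F, hF, hcov⟩ := exists_coveredByForests h
  have h1 : H.edgeSet ⊆ ⋃ i, (F i).edgeSet := by
    intro e he
    induction e with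
    | _ u v =>
      obtain ⟨i, hi⟩ := hcov u v he
      exact Set.mem_iUnion.mpr ⟨i, hi⟩
  calc H.edgeSet.ncard ≤ (⋃ i, (F i).edgeSet).ncard := Set.ncard_le_ncard h1 (Set.toFinite _)
    _ ≤ ∑ i, (F i).edgeSet.ncard := Set.ncard_iUnion_le_of_fintype _
    _ ≤ ∑ _i : Fin k, Nat.card W :=
      Finset.sum_le_sum fun i _ => ncard_edgeSet_le_of_isAcyclic (hF i).2
    _ = k * Nat.card W := by simp
    _ ≤ lam * Nat.card W := Nat.mul_le_mul_right _ hk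

/-- As `A` and `B` are disjoint, the sum counts every crossing edge once, from its end in `A`. -/
theorem sum_neighbors_le_of_arboricity {V : Type*} [Fintype V] [DecidableEq V] {G : SimpleGraph V}
    [DecidableRel G.Adj]
    {A B : Finset V} (hAB : Disjoint A B) {lam : ℕ} {S : Set V} (hS : S = ↑(A ∪ B))
    (h : arboricity (G.induce S) ≤ lam) :
    ∑ v ∈ A, (B.filter (G.Adj v)).card ≤ lam * (A.card + B.card) := by
  classical
  subst hS
  have h1 := ncard_edgeSet_le_of_arboricity h
  rw [Nat.card_coe_set_eq, Set.ncard_coe_finset, Finset.card_union_of_disjoint hAB] at h1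
  refine le_trans ?_ (h1.trans' (Set.ncard_image_le (f := Sym2.map Subtype.val) (Set.toFinite _)))
  rw [← Finset.card_sigma, ← Set.ncard_coe_finset]
  refine Set.ncard_le_ncard_of_injOn (fun p => s(p.1, p.2)) ?_ ?_ (Set.toFinite _)
  · rintro ⟨u, v⟩ hp
    simp only [Finset.coe_sigma, Set.mem_sigma_iff, Finset.mem_coe, Finset.mem_filter] at hp
    exact ⟨s(⟨u, by simp [hp.1]⟩, ⟨v, by simp [hp.2.1]⟩), hp.2.2, rfl⟩
  · rintro ⟨u, v⟩ hp ⟨u', v'⟩ hp' he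
    simp only [Finset.coe_sigma, Set.mem_sigma_iff, Finset.mem_coe, Finset.mem_filter] at hp hp'
    rcases Sym2.eq_iff.mp he with ⟨rfl, rfl⟩ | ⟨rfl, rfl⟩
    · rfl
    · exact absurd hp'.2.1 (Finset.disjoint_left.mp hAB hp.1)

/-! ### Lowest ranks -/

/-- A prefix of a sorted family has at most average size. -/
theorem card_mul_sum_le_of_lower {V : Type*} [DecidableEq V] {S R : Finset V} (hR : R ⊆ S)
    {d : V → ℕ} (h : ∀ v ∈ R, ∀ w ∈ S \ R, d v ≤ d w) :
    S.card * ∑ v ∈ R, d v ≤ R.card * ∑ v ∈ S, d v := by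
  have h1 : (S \ R).card * ∑ v ∈ R, d v ≤ R.card * ∑ w ∈ S \ R, d w := by
    calc (S \ R).card * ∑ v ∈ R, d v = ∑ v ∈ R, ∑ _w ∈ S \ R, d v := by
          simp [Finset.mul_sum]
      _ ≤ ∑ v ∈ R, ∑ w ∈ S \ R, d w :=
          Finset.sum_le_sum fun v hv => Finset.sum_le_sum fun w hw => h v hv w hw
      _ = R.card * ∑ w ∈ S \ R, d w := by simp
  have h2 := Finset.sum_sdiff (f := d) hR
  have h3 := Finset.card_sdiff_add_card_eq_card hR
  rw [← h2, ← h3, add_mul, mul_add]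
  omega

/-- The elements of rank less than `j / T` times the cardinality. -/
def lowRanks {V : Type*} (S : Finset V) (rank : V → ℕ) (T j : ℕ) : Finset V :=
  S.filter fun v => T * (rank v + 1) ≤ j * S.card

section Ranks

variable {V : Type*} {S : Finset V} {rank : V → ℕ} {T j : ℕ}

theorem image_rank_eq_range (hinj : Set.InjOn rank S) (hlt : ∀ v ∈ S, rank v < S.card) :
    S.image rank = Finset.range S.card := by
  apply Finset.eq_of_subset_of_card_le
  · intro i hi
    obtain ⟨v, hv, rfl⟩ := Finset.mem_image.mp hi
    exact Finset.mem_range.mpr (hlt v hv)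
  · rw [Finset.card_image_of_injOn hinj, Finset.card_range]

theorem card_lowRanks_le (hinj : Set.InjOn rank S) :
    T * (lowRanks S rank T j).card ≤ j * S.card := by
  by_contra hcon
  push Not at hcon
  rcases Nat.eq_zero_or_pos T with rfl | hT
  · simp at hcon
  have h1 : (lowRanks S rank T j).image rank ⊆ Finset.range ((lowRanks S rank T j).card - 1) := by
    intro i hi
    obtain ⟨v, hv, rfl⟩ := Finset.mem_image.mp hi
    have hv2 := (Finset.mem_filter.mp hv).2
    have := lt_of_mul_lt_mul_left (hv2.trans_lt hcon) (Nat.zero_le T)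
    rw [Finset.mem_range]
    omega
  have h2 := Finset.card_le_card h1
  rw [Finset.card_image_of_injOn (hinj.mono (by
    intro v hv
    exact (Finset.mem_filter.mp hv).1)), Finset.card_range] at h2
  have h3 : (lowRanks S rank T j).card = 0 := by omega
  rw [h3] at hcon
  omega

/-- All ranks below ⌊j|S| / T⌋ qualify, and rounding down loses less than one element. -/
theorem le_card_lowRanks (hinj : Set.InjOn rank S) (hlt : ∀ v ∈ S, rank v < S.card)
    (hj : j ≤ T) (hT : 0 < T) : j * S.card ≤ T * (lowRanks S rank T j).card + T := by
  have h1 : Finset.range (j * S.card / T) ⊆ (lowRanks S rank T j).image rank := by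
    intro i hi
    rw [Finset.mem_range] at hi
    have h2 : i + 1 ≤ j * S.card / T := hi
    rw [Nat.le_div_iff_mul_le hT] at h2
    have h3 : i < S.card := by
      have : (i + 1) * T ≤ S.card * T := h2.trans (by rw [mul_comm]; gcongr)
      exact Nat.le_of_mul_le_mul_right this hT
    have h4 : i ∈ S.image rank := by
      rw [image_rank_eq_range hinj hlt]
      exact Finset.mem_range.mpr h3
    obtain ⟨v, hv, rfl⟩ := Finset.mem_image.mp h4
    exact Finset.mem_image_of_mem _ (Finset.mem_filter.mpr ⟨hv, by linarith⟩)
  have h2 := (Finset.card_le_card h1).trans Finset.card_image_le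
  rw [Finset.card_range] at h2
  have h3 := Nat.div_add_mod (j * S.card) T
  have h4 := Nat.mod_lt (j * S.card) hT
  have h5 := Nat.mul_le_mul_left T h2
  omega

theorem sum_lowRanks_le (hinj : Set.InjOn rank S) {d : V → ℕ}
    (hd : ∀ v ∈ S, ∀ w ∈ S, rank v < rank w → d v ≤ d w) :
    T * ∑ v ∈ lowRanks S rank T j, d v ≤ j * ∑ v ∈ S, d v := by
  classical
  rcases Nat.eq_zero_or_pos S.card with h0 | hpos
  · rw [Finset.card_eq_zero] at h0
    subst h0
    simp [lowRanks]
  · have h1 : S.card * ∑ v ∈ lowRanks S rank T j, d v ≤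
        (lowRanks S rank T j).card * ∑ v ∈ S, d v := by
      apply card_mul_sum_le_of_lower (Finset.filter_subset _ _)
      intro v hv w hw
      obtain ⟨hv1, hv2⟩ := Finset.mem_filter.mp hv
      obtain ⟨hw1, hw2⟩ := Finset.mem_sdiff.mp hw
      apply hd v hv1 w hw1
      by_contra hcon
      apply hw2
      refine Finset.mem_filter.mpr ⟨hw1, le_trans ?_ hv2⟩
      gcongr
      omega
    have h2 := card_lowRanks_le (T := T) (j := j) hinj
    have h3 : S.card * (T * ∑ v ∈ lowRanks S rank T j, d v) ≤ S.card * (j * ∑ v ∈ S, d v) := by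
      calc S.card * (T * ∑ v ∈ lowRanks S rank T j, d v)
          = T * (S.card * ∑ v ∈ lowRanks S rank T j, d v) := by ring
        _ ≤ T * ((lowRanks S rank T j).card * ∑ v ∈ S, d v) := by gcongr
        _ = (T * (lowRanks S rank T j).card) * ∑ v ∈ S, d v := by ring
        _ ≤ (j * S.card) * ∑ v ∈ S, d v := by gcongr
        _ = S.card * (j * ∑ v ∈ S, d v) := by ring
    exact Nat.le_of_mul_le_mul_left h3 hpos

end Ranks

/-! ### The cost of a step -/

/-- With u = (j + 1) / T, insertions are bounded by the fraction u, while removals lag behind u·a by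
at most a/T + K, which `δ` pays for. -/
theorem step_cost_le {a b k r q M lam T j K δ : ℝ} (ha : 0 ≤ a) (hb : 0 ≤ b) (hk : 0 ≤ k)
    (hlam : 1 ≤ lam) (hT : 0 < T) (hj : 0 ≤ j) (haM : a + k ≤ M) (hbM : b + k ≤ M)
    (hr : j * a ≤ T * r + T * K) (hqb : q ≤ b) (hq : T * q ≤ (j + 1) * (lam * (a + b)))
    (hδ : a / T + K ≤ δ) :
    k + a - r + q ≤ (2 - 1 / (2 * lam)) * M + δ := by
  set u := (j + 1) / T with hu
  have hu0 : 0 ≤ u := by positivity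
  have hr' : u * a - a / T - K ≤ r := by
    have : u * a - a / T - K = (j * a - T * K) / T := by rw [hu]; field_simp; ring
    rw [this, div_le_iff₀ hT]
    linarith
  have hq' : q ≤ u * (lam * (a + b)) := by
    have : u * (lam * (a + b)) = ((j + 1) * (lam * (a + b))) / T := by rw [hu]; ring
    rw [this, le_div_iff₀ hT]
    linarith
  suffices h : k + a - u * a + q ≤ (2 - 1 / (2 * lam)) * M by linarith
  set m := M - k with hm
  have ham : a ≤ m := by linarith
  have hbm : b ≤ m := by linarith
  have hinv : 1 / (2 * lam) ≤ 1 / 2 := by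
    apply one_div_le_one_div_of_le <;> linarith
  suffices h : a - u * a + q ≤ (2 - 1 / (2 * lam)) * m by
    have hMm : M = m + k := by rw [hm]; ring
    rw [hMm]
    nlinarith
  rcases eq_or_lt_of_le (add_nonneg ha hb) with h0 | hpos
  · have ha0 : a = 0 := by linarith
    have hb0 : b = 0 := by linarith
    have : 0 ≤ m := by linarith
    subst ha0
    nlinarith
  · have hD : 0 < lam * (a + b) := by positivity
    have haD : a ≤ lam * (a + b) := by nlinarith
    -- The fraction at which the edge bound on `q` reaches `b`. Up to `z` the bound on the cost
    -- grows in `u`, because a ≤ λ(a + b); beyond it the bound falls with slope -a.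
    set z := b / (lam * (a + b)) with hz
    have hz0 : 0 ≤ z := by positivity
    have hzD : z * (lam * (a + b)) = b := by rw [hz]; field_simp
    have key : a - u * a + q ≤ a + b - z * a := by
      rcases le_total u z with huz | huz
      · have : u * (lam * (a + b) - a) ≤ z * (lam * (a + b) - a) :=
          mul_le_mul_of_nonneg_right huz (by linarith)
        nlinarith
      · have : z * a ≤ u * a := mul_le_mul_of_nonneg_right huz ha
        linarith
    refine key.trans ?_
    have hza : z * a = (1 / lam) * (a * b / (a + b)) := by rw [hz]; field_simp
    have hlam1 : 1 / lam ≤ 1 := by rw [div_le_one] <;> linarith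
    have hlam0 : 0 < 1 / lam := by positivity
    -- The case λ = 1, equivalent to a² + ab + b² ≤ (3/2)m(a + b). Larger λ follows, since 1/λ ≤ 1
    -- and the right side is nonnegative.
    have hmid : m / 2 - a * b / (a + b) ≤ 2 * m - (a + b) := by
      have : 0 ≤ a * b / (a + b) - (a + b) + 3 / 2 * m := by
        have he : a * b / (a + b) - (a + b) + 3 / 2 * m =
            (a * b - (a + b) ^ 2 + 3 / 2 * m * (a + b)) / (a + b) := by field_simp
        rw [he]
        apply div_nonneg _ hpos.le
        nlinarith [mul_nonneg ha (sub_nonneg.mpr ham), mul_nonneg hb (sub_nonneg.mpr hbm),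
          mul_nonneg ha (sub_nonneg.mpr hbm), mul_nonneg hb (sub_nonneg.mpr ham)]
      linarith
    have hnn : 0 ≤ 2 * m - (a + b) := by linarith
    have e : 1 / (2 * lam) = 1 / lam / 2 := by field_simp
    rw [hza, e]
    have : (1 / lam) * (m / 2 - a * b / (a + b)) ≤ 2 * m - (a + b) := by
      rcases le_total (m / 2 - a * b / (a + b)) 0 with h | h
      · nlinarith
      · nlinarith
    nlinarith

/-! ### The schedule -/

section Schedule

variable {V : Type*} (G : SimpleGraph V) (ident : V → ℕ) (x : V → Bool × Bool) (L : V → ℕ)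

/-- The number of neighbours that are only in the second vertex cover. -/
noncomputable def crossDegree (v : V) : ℕ := {w | G.Adj v w ∧ x w = (false, true)}.ncard

/-- The order in which the vertices of a cluster are removed: by degree, then by identifier. -/
def Before (u v : V) : Prop :=
  crossDegree G x u < crossDegree G x v ∨
    (crossDegree G x u = crossDegree G x v ∧ ident u < ident v)

/-- The number of vertices of the same cluster that are removed before `v`. -/
noncomputable def clusterRank (v : V) : ℕ :=
  {u | L u = L v ∧ x u = (true, false) ∧ Before G ident x u v}.ncard

/-- The number of vertices of the same cluster that have to be removed. -/
noncomputable def clusterSize (v : V) : ℕ := {u | L u = L v ∧ x u = (true, false)}.ncard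

/-- The vertex `v` is among those that are removed by time `j`, out of `T`. -/
def Removed (T j : ℕ) (v : V) : Prop :=
  x v = (true, false) ∧ T * (clusterRank G ident x L v + 1) ≤ j * clusterSize x L v

/-- The vertex `v` is among those that are inserted by time `j`. -/
def Inserted (T j : ℕ) (v : V) : Prop :=
  x v = (false, true) ∧ (T < j ∨ ∃ u, G.Adj v u ∧ Removed G ident x L T j u)

/-- The vertex `v` belongs to the `i`-th vertex cover of the schedule. -/
def InCover (T i : ℕ) (v : V) : Prop :=
  x v = (true, true) ∨ (x v = (true, false) ∧ ¬ Removed G ident x L T (i / 2) v) ∨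
    Inserted G ident x L T ((i + 1) / 2) v

variable {G ident x L} {T : ℕ}

theorem Removed.mono {i j : ℕ} (hij : i ≤ j) {v : V} (h : Removed G ident x L T i v) :
    Removed G ident x L T j v :=
  ⟨h.1, h.2.trans (Nat.mul_le_mul_right _ hij)⟩

theorem Inserted.mono {i j : ℕ} (hij : i ≤ j) {v : V} (h : Inserted G ident x L T i v) :
    Inserted G ident x L T j v :=
  ⟨h.1, h.2.imp (fun h => h.trans_le hij) fun ⟨u, hu, hr⟩ => ⟨u, hu, hr.mono hij⟩⟩

section Finite

variable [Finite V]

theorem clusterRank_lt_of_before {v w : V} (hvw : L v = L w) (hv : x v = (true, false))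
    (h : Before G ident x v w) : clusterRank G ident x L v < clusterRank G ident x L w := by
  apply Set.ncard_lt_ncard _ (Set.toFinite _)
  refine ⟨?_, fun hcon => ?_⟩
  · rintro u ⟨h1, h2, h3⟩
    refine ⟨h1.trans hvw, h2, ?_⟩
    unfold Before at h h3 ⊢
    omega
  · have := (hcon (show v ∈ _ from ⟨hvw, hv, h⟩)).2.2
    unfold Before at this
    omega

theorem clusterRank_lt_clusterSize {v : V} (hv : x v = (true, false)) :
    clusterRank G ident x L v < clusterSize x L v := by
  apply Set.ncard_lt_ncard _ (Set.toFinite _)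
  refine ⟨fun u hu => ⟨hu.1, hu.2.1⟩, fun hcon => ?_⟩
  have := (hcon (show v ∈ _ from ⟨rfl, hv⟩)).2.2
  unfold Before at this
  omega

theorem removed_self {v : V} (hv : x v = (true, false)) : Removed G ident x L T T v :=
  ⟨hv, Nat.mul_le_mul_left _ (clusterRank_lt_clusterSize hv)⟩

end Finite

theorem not_removed_zero (hT : 0 < T) {v : V} : ¬ Removed G ident x L T 0 v := by
  intro h
  have := h.2
  rw [zero_mul, Nat.le_zero, mul_eq_zero] at this
  omega

variable [DecidableEq V] {α β : Finset V}

theorem input_eq (v : V) :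
    ((decide (v ∈ α), decide (v ∈ β)) = (true, false) ↔ v ∈ α \ β) ∧
    ((decide (v ∈ α), decide (v ∈ β)) = (false, true) ↔ v ∈ β \ α) ∧
    ((decide (v ∈ α), decide (v ∈ β)) = (true, true) ↔ v ∈ α ∩ β) := by
  simp [and_comm]

theorem card_union_le_two_mul_max : (α ∪ β).card ≤ 2 * max α.card β.card := by
  have := Finset.card_union_le α β
  omega

/-- Bounds the number of clusters in which rounding can lose a vertex: they are disjoint and each
holds at least `τ` vertices of `α ∪ β`. -/
theorem card_image_label_le (hx : x = fun v => (decide (v ∈ α), decide (v ∈ β))) {τ D : ℕ}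
    (hL : IsClustering G (unionSet x) L τ D) :
    ((α \ β).image L).card ≤ 1 ∨ ((α \ β).image L).card * τ ≤ 2 * max α.card β.card := by
  rcases hL.weight_ge with h | h
  · right
    refine le_trans ?_ card_union_le_two_mul_max
    rw [Finset.card_eq_sum_card_image L (α ∪ β), ← smul_eq_mul, ← Finset.sum_const]
    refine le_trans (Finset.sum_le_sum (g := fun y => ((α ∪ β).filter fun v => L v = y).card)
      fun y hy => ?_) (Finset.sum_le_sum_of_subset (Finset.image_subset_image
        (Finset.sdiff_subset.trans Finset.subset_union_left)))
    obtain ⟨v, -, rfl⟩ := Finset.mem_image.mp hy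
    refine (h v).trans (le_of_eq ?_)
    rw [← Set.ncard_coe_finset]
    unfold weight
    congr 1
    ext u
    simp [unionSet, hx]
  · left
    rw [Finset.card_le_one]
    intro a ha b hb
    obtain ⟨v, -, rfl⟩ := Finset.mem_image.mp ha
    obtain ⟨w, -, rfl⟩ := Finset.mem_image.mp hb
    exact h v w

/-- Inserting all of the second vertex cover and then removing the rest of the first one. -/
theorem isApproxSchedule_union (hα : G.IsVertexCover (α : Set V))
    (hβ : G.IsVertexCover (β : Set V)) {η : ℝ}
    (hη : ((α ∪ β).card : ℝ) ≤ η * (max α.card β.card : ℕ) + 1) :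
    IsApproxSchedule G α β 2 η 1
      (fun i => if i = 0 then α else if i = 1 then α ∪ β else β) := by
  refine ⟨?_, by simp, by simp, ?_, ?_⟩
  · intro i _ u v huv
    have h1 := hα huv
    have h2 := hβ huv
    simp only [Finset.mem_coe] at h1 h2 ⊢
    split_ifs
    · exact h1
    · simp only [Finset.mem_union]; tauto
    · exact h2
  · intro i hi
    interval_cases i <;> simpa using hη
  · intro i hi u hu v hv _ huv
    have h1 := hα huv
    have h2 := hβ huv
    simp only [Finset.mem_coe] at h1 h2
    interval_cases i <;> simp [Set.mem_symmDiff] at hu hv <;> tauto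

/-! ### Counting removals and insertions cluster by cluster -/

variable [Fintype V]

open Classical in
theorem removed_fiber (hx : x = fun v => (decide (v ∈ α), decide (v ∈ β))) (j y : ℕ) :
    (Finset.univ.filter (Removed G ident x L T j)).filter (fun v => L v = y) =
      lowRanks ((α \ β).filter fun v => L v = y) (clusterRank G ident x L) T j := by
  ext v
  simp only [lowRanks, Finset.mem_filter, Finset.mem_univ, true_and]
  have hmem : x v = (true, false) ↔ v ∈ α \ β := by rw [hx]; exact (input_eq v).1
  have hsize : L v = y → clusterSize x L v = ((α \ β).filter fun v => L v = y).card := by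
    rintro rfl
    rw [← Set.ncard_coe_finset]
    unfold clusterSize
    congr 1
    ext u
    have : x u = (true, false) ↔ u ∈ α \ β := by rw [hx]; exact (input_eq u).1
    simp only [Set.mem_ofPred_eq, this, Finset.coe_filter, and_comm]
  constructor
  · rintro ⟨⟨h1, h2⟩, h3⟩
    exact ⟨⟨hmem.mp h1, h3⟩, by rw [← hsize h3]; exact h2⟩
  · rintro ⟨⟨h1, h3⟩, h2⟩
    exact ⟨⟨hmem.mpr h1, by rw [hsize h3]; exact h2⟩, h3⟩

theorem injOn_clusterRank (hx : x = fun v => (decide (v ∈ α), decide (v ∈ β)))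
    (hinj : Function.Injective ident) (y : ℕ) :
    Set.InjOn (clusterRank G ident x L) ((α \ β).filter fun v => L v = y) := by
  intro v hv w hw he
  rw [Finset.mem_coe, Finset.mem_filter] at hv hw
  have h1 : x v = (true, false) := by rw [hx]; exact (input_eq v).1.mpr hv.1
  have h2 : x w = (true, false) := by rw [hx]; exact (input_eq w).1.mpr hw.1
  by_contra hne
  have hid : ident v ≠ ident w := fun h => hne (hinj h)
  have : Before G ident x v w ∨ Before G ident x w v := by
    unfold Before
    omega
  rcases this with h | h
  · have := clusterRank_lt_of_before (hv.2.trans hw.2.symm) h1 h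
    omega
  · have := clusterRank_lt_of_before (hw.2.trans hv.2.symm) h2 h
    omega

open Classical in
theorem card_removed_ge (hx : x = fun v => (decide (v ∈ α), decide (v ∈ β)))
    (hinj : Function.Injective ident) {j : ℕ} (hj : j ≤ T) (hT : 0 < T) :
    j * (α \ β).card ≤ T * (Finset.univ.filter (Removed G ident x L T j)).card +
      T * ((α \ β).image L).card := by
  have hsub : ∀ v ∈ Finset.univ.filter (Removed G ident x L T j), L v ∈ (α \ β).image L := by
    intro v hv
    apply Finset.mem_image_of_mem
    have := (Finset.mem_filter.mp hv).2.1
    rw [hx] at this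
    exact (input_eq v).1.mp this
  rw [Finset.card_eq_sum_card_fiberwise (f := L) (s := α \ β) (t := (α \ β).image L)
      (fun v hv => Finset.mem_image_of_mem _ hv),
    Finset.card_eq_sum_card_fiberwise hsub, Finset.mul_sum, Finset.mul_sum,
    mul_comm T (Finset.card _),
    ← smul_eq_mul (Finset.card _) T, ← Finset.sum_const, ← Finset.sum_add_distrib]
  refine Finset.sum_le_sum fun y _ => ?_
  rw [removed_fiber hx]
  refine le_card_lowRanks (injOn_clusterRank hx hinj y) (fun v hv => ?_) hj hT
  rw [Finset.mem_filter] at hv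
  have h1 : x v = (true, false) := by rw [hx]; exact (input_eq v).1.mpr hv.1
  refine (clusterRank_lt_clusterSize h1).trans_le ?_
  rw [← Set.ncard_coe_finset]
  apply Set.ncard_le_ncard _ (Set.toFinite _)
  rintro u ⟨hu1, hu2⟩
  rw [hx] at hu2
  rw [Finset.mem_coe, Finset.mem_filter]
  exact ⟨(input_eq u).1.mp hu2, hu1.trans hv.2⟩

-- Every cluster removes a prefix of its own order with the same fraction j/T, so the averaging
-- bounds add up and no global order is needed.
open Classical in
theorem sum_removed_le (hx : x = fun v => (decide (v ∈ α), decide (v ∈ β)))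
    (hinj : Function.Injective ident) (j : ℕ) :
    T * ∑ v ∈ Finset.univ.filter (Removed G ident x L T j), crossDegree G x v ≤
      j * ∑ v ∈ α \ β, crossDegree G x v := by
  have hsub : ∀ v ∈ Finset.univ.filter (Removed G ident x L T j), L v ∈ (α \ β).image L := by
    intro v hv
    apply Finset.mem_image_of_mem
    have := (Finset.mem_filter.mp hv).2.1
    rw [hx] at this
    exact (input_eq v).1.mp this
  rw [← Finset.sum_fiberwise_of_maps_to hsub,
    ← Finset.sum_fiberwise_of_maps_to (s := α \ β) (g := L) (t := (α \ β).image L)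
      (fun v hv => Finset.mem_image_of_mem _ hv), Finset.mul_sum, Finset.mul_sum]
  refine Finset.sum_le_sum fun y _ => ?_
  rw [removed_fiber hx]
  refine sum_lowRanks_le (injOn_clusterRank hx hinj y) ?_
  intro v hv w hw hlt
  rw [Finset.mem_filter] at hv hw
  have h2 : x w = (true, false) := by rw [hx]; exact (input_eq w).1.mpr hw.1
  by_contra hcon
  push Not at hcon
  have := clusterRank_lt_of_before (G := G) (ident := ident) (hw.2.trans hv.2.symm) h2
    (Or.inl hcon)
  omega

open Classical in
theorem card_inserted_le {j : ℕ} (hj : j ≤ T) :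
    (Finset.univ.filter (Inserted G ident x L T j)).card ≤
      ∑ v ∈ Finset.univ.filter (Removed G ident x L T j), crossDegree G x v := by
  have : Finset.univ.filter (Inserted G ident x L T j) ⊆
      (Finset.univ.filter (Removed G ident x L T j)).biUnion
        fun v => Finset.univ.filter fun w => G.Adj v w ∧ x w = (false, true) := by
    intro v hv
    obtain ⟨h1, h2⟩ := (Finset.mem_filter.mp hv).2
    obtain ⟨u, hu, hr⟩ := h2.resolve_left (by omega)
    simp only [Finset.mem_biUnion, Finset.mem_filter, Finset.mem_univ, true_and]
    exact ⟨u, hr, hu.symm, h1⟩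
  refine (Finset.card_le_card this).trans (Finset.card_biUnion_le.trans ?_)
  refine Finset.sum_le_sum fun v _ => le_of_eq ?_
  rw [← Set.ncard_coe_finset]
  simp [crossDegree]

theorem sum_crossDegree_le (hx : x = fun v => (decide (v ∈ α), decide (v ∈ β))) {lam : ℕ}
    (h : arboricity (G.induce (symmDiff α β : Finset V)) ≤ lam) :
    ∑ v ∈ α \ β, crossDegree G x v ≤ lam * ((α \ β).card + (β \ α).card) := by
  classical
  refine le_trans (le_of_eq (Finset.sum_congr rfl fun v _ => ?_))
    (sum_neighbors_le_of_arboricity (A := α \ β) (B := β \ α) disjoint_sdiff_sdiff rfl h)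
  rw [← Set.ncard_coe_finset]
  unfold crossDegree
  congr 1
  ext w
  have : x w = (false, true) ↔ w ∈ β \ α := by rw [hx]; exact (input_eq w).2.1
  simp only [Set.mem_ofPred_eq, this, Finset.coe_filter, and_comm]

-- Insertions and removals alternate, the neighbours of a slice entering just before it leaves. The
-- additional time T + 1 inserts the vertices of `β \ α` without neighbours in `α \ β`.
open Classical in
theorem isApproxSchedule_inCover (hx : x = fun v => (decide (v ∈ α), decide (v ∈ β)))
    (hinj : Function.Injective ident) (hα : G.IsVertexCover (α : Set V))
    (hβ : G.IsVertexCover (β : Set V)) {lam : ℕ} (hlam : 1 ≤ lam)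
    (harb : arboricity (G.induce (symmDiff α β : Finset V)) ≤ lam) {τ D : ℕ}
    (hL : IsClustering G (unionSet x) L τ D) {ε : ℝ} (hε : 0 < ε) (hτ : 4 / ε ≤ τ)
    (hT : 2 / ε ≤ T) :
    IsApproxSchedule G α β (2 * T + 1) (2 - 1 / (2 * lam) + ε) 1
      (fun i => Finset.univ.filter (InCover G ident x L T i)) := by
  have hT0 : 0 < T := by
    have : (0 : ℝ) < T := lt_of_lt_of_le (by positivity) hT
    exact_mod_cast this
  have hA : ∀ v, x v = (true, false) ↔ v ∈ α \ β := fun v => by rw [hx]; exact (input_eq v).1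
  have hB : ∀ v, x v = (false, true) ↔ v ∈ β \ α := fun v => by rw [hx]; exact (input_eq v).2.1
  have hC : ∀ v, x v = (true, true) ↔ v ∈ α ∩ β := fun v => by rw [hx]; exact (input_eq v).2.2
  have hlam' : (1 : ℝ) ≤ lam := by exact_mod_cast hlam
  have hM0 : (0 : ℝ) ≤ (max α.card β.card : ℕ) := Nat.cast_nonneg _
  refine ⟨?_, ?_, ?_, ?_, ?_⟩
  · intro i _ u v huv
    have key : ∀ u v, G.Adj u v → u ∈ α \ β → v ∈ β \ α →
        InCover G ident x L T i u ∨ InCover G ident x L T i v := by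
      intro u v huv hu hv
      by_cases hr : Removed G ident x L T (i / 2) u
      · right; right; right
        exact ⟨(hB v).mpr hv, Or.inr ⟨u, huv.symm, hr.mono (by omega)⟩⟩
      · left; right; left
        exact ⟨(hA u).mpr hu, hr⟩
    have hC' : ∀ w, w ∈ α → w ∈ β → InCover G ident x L T i w :=
      fun w h1 h2 => Or.inl ((hC w).mpr (Finset.mem_inter.mpr ⟨h1, h2⟩))
    have h1 := hα huv
    have h2 := hβ huv
    simp only [Finset.mem_coe] at h1 h2
    suffices h : InCover G ident x L T i u ∨ InCover G ident x L T i v by simpa using h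
    by_cases hu1 : u ∈ α <;> by_cases hu2 : u ∈ β
    · exact Or.inl (hC' u hu1 hu2)
    · have hv2 := h2.resolve_left hu2
      by_cases hv1 : v ∈ α
      · exact Or.inr (hC' v hv1 hv2)
      · exact key u v huv (Finset.mem_sdiff.mpr ⟨hu1, hu2⟩) (Finset.mem_sdiff.mpr ⟨hv2, hv1⟩)
    · have hv1 := h1.resolve_left hu1
      by_cases hv2 : v ∈ β
      · exact Or.inr (hC' v hv1 hv2)
      · exact (key v u huv.symm (Finset.mem_sdiff.mpr ⟨hv1, hv2⟩)
          (Finset.mem_sdiff.mpr ⟨hu2, hu1⟩)).symm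
    · exact Or.inr (hC' v (h1.resolve_left hu1) (h2.resolve_left hu2))
  · ext v
    simp only [InCover, Inserted, Finset.mem_filter, Finset.mem_univ, true_and, hA, hC, hB,
      Nat.zero_div, not_removed_zero hT0, Finset.mem_inter, Finset.mem_sdiff]
    norm_num
    tauto
  · ext v
    have e1 : (2 * T + 1) / 2 = T := by omega
    have e2 : (2 * T + 1 + 1) / 2 = T + 1 := by omega
    simp only [InCover, Inserted, Finset.mem_filter, Finset.mem_univ, true_and, e1, e2,
      Nat.lt_succ_self, true_or, and_true, hB, hC]
    have : ¬ (x v = (true, false) ∧ ¬ Removed G ident x L T T v) := fun h => h.2 (removed_self h.1)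
    simp only [this, false_or, Finset.mem_inter, Finset.mem_sdiff]
    tauto
  · intro i hi
    obtain ⟨j, hj⟩ : ∃ j, j = i / 2 := ⟨_, rfl⟩
    have hjT : j ≤ T := by omega
    set R := Finset.univ.filter (Removed G ident x L T j) with hR
    set I := Finset.univ.filter (Inserted G ident x L T (j + 1)) with hI
    have hRA : R ⊆ α \ β := fun v hv => (hA v).mp (Finset.mem_filter.mp hv).2.1
    have hIB : I ⊆ β \ α := fun v hv => (hB v).mp (Finset.mem_filter.mp hv).2.1
    have hsub : Finset.univ.filter (InCover G ident x L T i) ∪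
        Finset.univ.filter (InCover G ident x L T (i + 1)) ⊆ (α ∩ β) ∪ ((α \ β) \ R) ∪ I := by
      have hin : ∀ k v, i ≤ k → k ≤ i + 1 → InCover G ident x L T k v →
          v ∈ (α ∩ β) ∪ ((α \ β) \ R) ∪ I := by
        rintro k v hk1 hk2 (h | ⟨h1, h2⟩ | h)
        · exact Finset.mem_union_left _ (Finset.mem_union_left _ ((hC v).mp h))
        · refine Finset.mem_union_left _ (Finset.mem_union_right _
            (Finset.mem_sdiff.mpr ⟨(hA v).mp h1, fun hr => h2 ?_⟩))
          exact (Finset.mem_filter.mp hr).2.mono (by omega)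
        · exact Finset.mem_union_right _ (Finset.mem_filter.mpr ⟨Finset.mem_univ _,
            h.mono (by omega)⟩)
      intro v hv
      rcases Finset.mem_union.mp hv with hv | hv
      · exact hin i v le_rfl (by omega) (Finset.mem_filter.mp hv).2
      · exact hin (i + 1) v (by omega) le_rfl (Finset.mem_filter.mp hv).2
    have hcard : (Finset.univ.filter (InCover G ident x L T i) ∪
        Finset.univ.filter (InCover G ident x L T (i + 1))).card + R.card ≤
        (α ∩ β).card + (α \ β).card + I.card := by
      have h1 := Finset.card_le_card hsub
      have h2 := Finset.card_union_le ((α ∩ β) ∪ ((α \ β) \ R)) I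
      have h3 := Finset.card_union_le (α ∩ β) ((α \ β) \ R)
      have h4 := Finset.card_sdiff_add_card_eq_card hRA
      omega
    have hαc := Finset.card_sdiff_add_card_inter α β
    have hβc := Finset.card_sdiff_add_card_inter β α
    rw [Finset.inter_comm] at hβc
    have hIc := Finset.card_le_card hIB
    have hcard' : ((Finset.univ.filter (InCover G ident x L T i) ∪
        Finset.univ.filter (InCover G ident x L T (i + 1))).card : ℝ) + R.card ≤
        (α ∩ β).card + (α \ β).card + I.card := by exact_mod_cast hcard
    have hαM : ((α \ β).card : ℝ) + (α ∩ β).card ≤ (max α.card β.card : ℕ) := by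
      rw [← Nat.cast_add, hαc]; exact_mod_cast le_max_left _ _
    have hβM : ((β \ α).card : ℝ) + (α ∩ β).card ≤ (max α.card β.card : ℕ) := by
      rw [← Nat.cast_add, hβc]; exact_mod_cast le_max_right _ _
    have hinv : 1 / (2 * (lam : ℝ)) ≤ 1 / 2 := by
      apply one_div_le_one_div_of_le <;> linarith
    have hIc' : (I.card : ℝ) ≤ (β \ α).card := by exact_mod_cast hIc
    -- At time `T` all of `α \ β` is gone, so the union lies within `β`. Earlier, j + 1 ≤ T makes
    -- the degree bound on insertions available.
    rcases eq_or_lt_of_le hjT with rfl | hlt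
    · have hRe : R = α \ β := by
        apply Finset.Subset.antisymm hRA
        intro v hv
        exact Finset.mem_filter.mpr ⟨Finset.mem_univ _, removed_self ((hA v).mpr hv)⟩
      rw [hRe] at hcard'
      nlinarith
    · have hge := card_removed_ge (G := G) (L := L) hx hinj hjT hT0
      rw [← hR] at hge
      have hle : T * I.card ≤ (j + 1) * (lam * ((α \ β).card + (β \ α).card)) := by
        calc T * I.card ≤ T * ∑ v ∈ Finset.univ.filter (Removed G ident x L T (j + 1)),
              crossDegree G x v := Nat.mul_le_mul_left _ (card_inserted_le (by omega))
          _ ≤ (j + 1) * ∑ v ∈ α \ β, crossDegree G x v := sum_removed_le hx hinj _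
          _ ≤ _ := Nat.mul_le_mul_left _ (sum_crossDegree_le hx harb)
      have hT' : (0 : ℝ) < T := by exact_mod_cast hT0
      have hK : (((α \ β).image L).card : ℝ) ≤ 1 + ε / 2 * (max α.card β.card : ℕ) := by
        rcases card_image_label_le hx hL with h | h
        · have : (((α \ β).image L).card : ℝ) ≤ 1 := by exact_mod_cast h
          have : 0 ≤ ε / 2 * ((max α.card β.card : ℕ) : ℝ) := by positivity
          linarith
        · have h1 : (((α \ β).image L).card : ℝ) * τ ≤ 2 * (max α.card β.card : ℕ) := by
            exact_mod_cast h
          have h2 : (((α \ β).image L).card : ℝ) * (4 / ε) ≤ 2 * (max α.card β.card : ℕ) :=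
            (mul_le_mul_of_nonneg_left hτ (Nat.cast_nonneg _)).trans h1
          rw [mul_div_assoc', div_le_iff₀ hε] at h2
          linarith
      have haT : ((α \ β).card : ℝ) / T ≤ ε / 2 * (max α.card β.card : ℕ) := by
        rw [div_le_iff₀ hT']
        rw [div_le_iff₀ hε] at hT
        have h1 : ((α \ β).card : ℝ) ≤ (max α.card β.card : ℕ) := by
          have : (0 : ℝ) ≤ (α ∩ β).card := Nat.cast_nonneg _
          linarith
        nlinarith
      have := step_cost_le (a := (α \ β).card) (b := (β \ α).card) (k := (α ∩ β).card)
        (r := R.card) (q := I.card) (M := (max α.card β.card : ℕ)) (lam := lam) (T := T) (j := j)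
        (K := ((α \ β).image L).card) (δ := ε * (max α.card β.card : ℕ) + 1)
        (Nat.cast_nonneg _) (Nat.cast_nonneg _) (Nat.cast_nonneg _) hlam' hT' (Nat.cast_nonneg _)
        hαM hβM (by exact_mod_cast hge) hIc' (by exact_mod_cast hle) (by linarith)
      rw [add_mul]
      linarith
  · intro i _
    -- Even batches only insert, outside `α`; odd batches only remove, outside `β`.
    rcases Nat.even_or_odd' i with ⟨j, rfl | rfl⟩
    · have hsub : ∀ v ∈ symmDiff (Finset.univ.filter (InCover G ident x L T (2 * j)))
          (Finset.univ.filter (InCover G ident x L T (2 * j + 1))), v ∉ α := by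
        intro v hv hvα
        have hnB : ∀ k, ¬ Inserted G ident x L T k v := fun k h =>
          (Finset.mem_sdiff.mp ((hB v).mp h.1)).2 hvα
        have e1 : 2 * j / 2 = j := by omega
        have e2 : (2 * j + 1) / 2 = j := by omega
        simp only [Finset.mem_symmDiff, Finset.mem_filter, Finset.mem_univ, true_and, InCover, e1,
          e2, hnB] at hv
        tauto
      intro u hu v hv _ huv
      rcases hα huv with h | h
      · exact hsub u hu h
      · exact hsub v hv h
    · have hsub : ∀ v ∈ symmDiff (Finset.univ.filter (InCover G ident x L T (2 * j + 1)))
          (Finset.univ.filter (InCover G ident x L T (2 * j + 1 + 1))), v ∉ β := by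
        intro v hv hvβ
        have hnA : x v ≠ (true, false) := fun h => (Finset.mem_sdiff.mp ((hA v).mp h)).2 hvβ
        have e1 : (2 * j + 1 + 1) / 2 = j + 1 := by omega
        have e2 : (2 * j + 1 + 1 + 1) / 2 = j + 1 := by omega
        simp only [Finset.mem_symmDiff, Finset.mem_filter, Finset.mem_univ, true_and, InCover, e1,
          e2, hnA, false_and] at hv
        tauto
      intro u hu v hv _ huv
      rcases hβ huv with h | h
      · exact hsub u hu h
      · exact hsub v hv h

end Schedule

/-! ### Locality of the schedule -/

namespace IsLocal

variable {n c r : ℕ}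

theorem crossDegree :
    IsLocal (n := n) (c := c) 1 (fun N v => VCReconf.crossDegree N.G N.input v) := by
  have : (fun (N : Network n c) (v : N.V) => VCReconf.crossDegree N.G N.input v) =
      fun N v => (Prod.fst '' {q : ℕ × Bool × Bool | q.2 = (false, true) ∧
        q ∈ {q | ∃ u, N.G.Adj v u ∧ q = (N.ident u, N.input u)}}).ncard := by
    funext N v
    unfold VCReconf.crossDegree
    rw [← Set.ncard_image_of_injective _ N.injective]
    congr 1
    ext i
    constructor
    · rintro ⟨u, ⟨hu1, hu2⟩, rfl⟩
      exact ⟨(N.ident u, N.input u), ⟨hu2, u, hu1, rfl⟩, rfl⟩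
    · rintro ⟨_, ⟨hu1, u, hu2, rfl⟩, rfl⟩
      exact ⟨u, ⟨hu2, hu1⟩, rfl⟩
  rw [this]
  exact (ident.prodMk input).neighbors.map (fun S =>
    (Prod.fst '' {q : ℕ × Bool × Bool | q.2 = (false, true) ∧ q ∈ S}).ncard)

variable {L : (N : Network n c) → N.V → ℕ} {D : ℕ}

theorem removed (hL : IsLocal r L) (hr : 1 ≤ r)
    (hD : ∀ (N : Network n c) (u v : N.V), L N u = L N v → N.G.dist u v ≤ D) (T j : ℕ) :
    IsLocal (r + D) (fun N v => Removed N.G N.ident N.input (L N) T j v) := by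
  have hF := (input.prodMk (ident.prodMk (crossDegree (n := n) (c := c)))).mono hr
  have h1 : IsLocal (r + D) (fun N v => clusterRank N.G N.ident N.input (L N) v) :=
    hL.cluster_ncard hF hD fun p q => p.1 = (true, false) ∧
      (p.2.2 < q.2.2 ∨ (p.2.2 = q.2.2 ∧ p.2.1 < q.2.1))
  have h2 : IsLocal (r + D) (fun N v => clusterSize N.input (L N) v) :=
    hL.cluster_ncard hF hD fun p _ => p.1 = (true, false)
  exact (input.prodMk (h1.prodMk h2)).map
    (fun q => q.1 = (true, false) ∧ T * (q.2.1 + 1) ≤ j * q.2.2)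

theorem inCover (hL : IsLocal r L) (hr : 1 ≤ r)
    (hD : ∀ (N : Network n c) (u v : N.V), L N u = L N v → N.G.dist u v ≤ D) (T i : ℕ) :
    IsLocal (r + D + 1) (fun N v => InCover N.G N.ident N.input (L N) T i v) := by
  have h1 : IsLocal (r + D + 1) (fun N v => Inserted N.G N.ident N.input (L N) T ((i + 1) / 2) v) := by
    -- A node collects the truth values of `Removed` at its neighbours as a set of propositions;
    -- some neighbour is removed exactly if `True` is among them.
    have : (fun (N : Network n c) v => Inserted N.G N.ident N.input (L N) T ((i + 1) / 2) v) =
        fun N v => N.input v = (false, true) ∧ (T < (i + 1) / 2 ∨ True ∈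
          {q | ∃ u, N.G.Adj v u ∧ q = Removed N.G N.ident N.input (L N) T ((i + 1) / 2) u}) := by
      funext N v
      simp [Inserted]
    rw [this]
    exact (input.prodMk (hL.removed hr hD T ((i + 1) / 2)).neighbors).map
      (fun q => q.1 = (false, true) ∧ (T < (i + 1) / 2 ∨ True ∈ q.2))
  exact (input.prodMk (((hL.removed hr hD T (i / 2)).mono (Nat.le_succ _)).prodMk h1)).map
    (fun q => q.1 = (true, true) ∨ (q.1 = (true, false) ∧ ¬ q.2.1) ∨ q.2.2)

theorem list_map {ι : Type*} {P : ι → (N : Network n c) → N.V → Prop}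
    (h : ∀ i, IsLocal r (P i)) (l : List ι) :
    IsLocal r (fun N v => l.map fun i => open Classical in decide (P i N v)) := by
  intro N N' v v' hv
  refine List.map_congr_left fun i _ => ?_
  exact decide_eq_decide.mpr (iff_of_eq (h i N N' v v' hv))

end IsLocal

/-! ### Outputs of the nodes and the final algorithm -/

theorem IsApproxSchedule.congr {V : Type*} [DecidableEq V] {G : SimpleGraph V} {α β : Finset V}
    {ℓ : ℕ} {η c : ℝ} {S S' : ℕ → Finset V} (h : IsApproxSchedule G α β ℓ η c S)
    (hS : ∀ i ≤ ℓ, S' i = S i) : IsApproxSchedule G α β ℓ η c S' where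
  isVertexCover i hi := by rw [hS i hi]; exact h.isVertexCover i hi
  first := by rw [hS 0 (Nat.zero_le _)]; exact h.first
  last := by rw [hS ℓ le_rfl]; exact h.last
  card_le i hi := by rw [hS i hi.le, hS (i + 1) hi]; exact h.card_le i hi
  independent i hi := by rw [hS i hi.le, hS (i + 1) hi]; exact h.independent i hi

/-- What a node with input `x` outputs in the schedule of length two. -/
def trivialOutput (x : Bool × Bool) : List Bool := [x.1, x.1 || x.2, x.2]

open Classical in
/-- What the nodes of a network output in the schedule with `T` time steps that is based on the
clustering obtained after `i` phases. -/
noncomputable def scheduleOutput {V : Type*} (G : SimpleGraph V) (ident : V → ℕ)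
    (x : V → Bool × Bool) (t i T : ℕ) (v : V) : List Bool :=
  (List.range (2 * T + 2)).map fun k =>
    decide (InCover G ident x (clusters G (unionSet x) ident t i) T k v)

theorem coverOf_scheduleOutput {V : Type*} [Fintype V] (G : SimpleGraph V) (ident : V → ℕ)
    (x : V → Bool × Bool) (t i T k : ℕ) (hk : k ≤ 2 * T + 1) :
    coverOf (scheduleOutput G ident x t i T) k = open Classical in
      Finset.univ.filter (InCover G ident x (clusters G (unionSet x) ident t i) T k) := by
  classical
  ext v
  have : k < 2 * T + 2 := by omega
  simp [coverOf, scheduleOutput, List.getElem?_map, List.getElem?_range this]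

theorem isLocal_scheduleOutput {n c t : ℕ} (ht : palette (n ^ c + c) t ≤ 8) (i T : ℕ) :
    IsLocal (n := n) (c := c) ((t + 19) * 97 * 2 ^ i)
      (fun N v => scheduleOutput N.G N.ident N.input t i T v) := by
  have h := IsLocal.clusters (n := n) (c := c) ht i
  have h1 := Nat.one_le_two_pow (n := i)
  refine (IsLocal.list_map (fun k => h.inCover (by nlinarith [Nat.zero_le (t * 2 ^ i)])
    (fun N => (isClustering_clusters N.cover_unionSet N.connected N.injective
      N.ident_lt ht i).dist_le) T k) _).mono ?_
  nlinarith

end VCReconf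

open VCReconf in
/-- The global parameters are `(n, lam)`, the private input of a node `v` is
`(v ∈ α, v ∈ β)`, and identifiers come from a space of size `n ^ c + c`. -/
theorem theorem5 :
    ∃ B : ℝ, ∀ c : ℕ, ∃ C : ℝ, ∀ ε : ℝ, 0 < ε →
      ∃ 𝒜 : VCReconf.LocalAlgorithm (ℕ × ℕ) (Bool × Bool) (List Bool),
        (∀ n lam : ℕ, (𝒜.rounds (n, lam) : ℝ) ≤ C * VCReconf.logStar n / ε) ∧
        ∀ (V : Type) [Fintype V] [DecidableEq V] (G : SimpleGraph V) (α β : Finset V)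
          (lam : ℕ) (ident : V → ℕ),
          G.Connected →
          G.IsVertexCover (α : Set V) →
          G.IsVertexCover (β : Set V) →
          1 ≤ lam →
          VCReconf.arboricity (G.induce (symmDiff α β : Finset V)) ≤ lam →
          Function.Injective ident →
          (∀ v, ident v < Fintype.card V ^ c + c) →
          ∃ ℓ : ℕ, (ℓ : ℝ) ≤ B * max 1 (lam / ε ^ 2) ∧
            (∀ v, (𝒜.result G (Fintype.card V, lam) ident
              (fun u => (decide (u ∈ α), decide (u ∈ β))) v).length = ℓ + 1) ∧
            VCReconf.IsApproxSchedule G α β ℓ (2 - 1 / (2 * lam) + ε) 1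
              (VCReconf.coverOf (𝒜.result G (Fintype.card V, lam) ident
                (fun u => (decide (u ∈ α), decide (u ∈ β))))) := by
  -- For ε < 1/2 there are 2T + 1 ≤ 4/ε + 3 batches. The round constant comes from the radius (t +
  -- 19) · 97 · 2^p with 2^p ≤ 16/ε.
  refine ⟨10, fun c => ⟨(2 ^ (c + 3) + 20) * 97 * 16, fun ε hε => ?_⟩⟩
  obtain ⟨p, hp⟩ : ∃ p : ℕ, ε < 1 / 2 → 8 / ε ≤ 2 ^ p ∧ (2 : ℝ) ^ p ≤ 16 / ε := by
    by_cases h : ε < 1 / 2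
    · obtain ⟨q, hq1, hq2⟩ := exists_nat_pow_near (x := 8 / ε) (y := 2)
        (by rw [le_div_iff₀ hε]; linarith) (by norm_num)
      refine ⟨q + 1, fun _ => ⟨hq2.le, ?_⟩⟩
      rw [pow_succ, show 16 / ε = 8 / ε * 2 by ring]
      linarith
    · exact ⟨0, fun h' => absurd h' h⟩
  classical
  set T := ⌈2 / ε⌉₊ with hT
  let t : ℕ → ℕ := fun n => logStar n + 2 ^ (c + 3)
  obtain ⟨𝒜, hrounds, hresult⟩ := exists_localAlgorithm c
    -- For ε ≥ 1/2 passing through `α ∪ β` is cheap enough, as 1/(2λ) ≤ 1/2. For n ≤ 1 it costs at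
    -- most 1, and no round is allowed because log* n = 0.
    (fun n => if 1 / 2 ≤ ε ∨ n ≤ 1 then 0 else (t n + 19) * 97 * 2 ^ p)
    (fun n N v => if 1 / 2 ≤ ε ∨ n ≤ 1 then trivialOutput (N.input v)
      else scheduleOutput N.G N.ident N.input (t n) p T v) (by
      intro n
      by_cases h : 1 / 2 ≤ ε ∨ n ≤ 1
      · simp only [if_pos h]
        exact IsLocal.input.map _
      · simp only [if_neg h]
        exact isLocal_scheduleOutput (palette_logStar n c (by omega)) p T)
  refine ⟨𝒜, fun n lam => ?_, ?_⟩
  · rw [hrounds]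
    split_ifs with h
    · simp only [Nat.cast_zero]
      positivity
    · push Not at h
      have hk : (1 : ℝ) ≤ logStar n := by exact_mod_cast logStar_pos (n := n) (by omega)
      have hp2 := (hp h.1).2
      have hc : (0 : ℝ) ≤ 2 ^ (c + 3) := by positivity
      have h1 : ((t n + 19 : ℕ) : ℝ) ≤ (2 ^ (c + 3) + 20) * logStar n := by
        simp only [t]
        push_cast
        nlinarith
      calc (((t n + 19) * 97 * 2 ^ p : ℕ) : ℝ) = ((t n + 19 : ℕ) : ℝ) * (97 * 2 ^ p) := by
            push_cast; ring
        _ ≤ ((2 ^ (c + 3) + 20) * logStar n) * (97 * (16 / ε)) := by gcongr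
        _ = _ := by ring
  · intro V _ _ G α β lam ident hG hα hβ hlam harb hinj hid
    let x : V → Bool × Bool := fun u => (decide (u ∈ α), decide (u ∈ β))
    let N : Network (Fintype.card V) c :=
      { V := V
        finite := inferInstance
        G := G
        ident := ident
        input := x
        connected := hG
        card := Nat.card_eq_fintype_card
        injective := hinj
        ident_lt := hid
        cover_fst := by simpa [x] using hα
        cover_snd := by simpa [x] using hβ }
    have hlam' : (1 : ℝ) ≤ lam := by exact_mod_cast hlam
    have hinv : 1 / (2 * (lam : ℝ)) ≤ 1 / 2 := by
      apply one_div_le_one_div_of_le <;> linarith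
    have hM0 : (0 : ℝ) ≤ (max α.card β.card : ℕ) := Nat.cast_nonneg _
    by_cases h : 1 / 2 ≤ ε ∨ Fintype.card V ≤ 1
    · have hout : 𝒜.result G (Fintype.card V, lam) ident x = fun v => trivialOutput (x v) := by
        funext v
        exact (hresult _ lam N v).trans (if_pos h)
      refine ⟨2, ?_, ?_, ?_⟩
      · have := le_max_left 1 ((lam : ℝ) / ε ^ 2)
        push_cast
        linarith
      · intro v
        rw [hout]
        rfl
      · rw [hout]
        refine (isApproxSchedule_union hα hβ ?_).congr fun i hi => ?_
        · rcases h with h | h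
          · have h1 : ((α ∪ β).card : ℝ) ≤ 2 * (max α.card β.card : ℕ) := by
              exact_mod_cast card_union_le_two_mul_max
            nlinarith
          · have h1 : ((α ∪ β).card : ℝ) ≤ 1 := by
              exact_mod_cast (Finset.card_le_univ _).trans h
            nlinarith
        · ext v
          interval_cases i <;> simp [coverOf, trivialOutput, x]
    · have hout : 𝒜.result G (Fintype.card V, lam) ident x =
          scheduleOutput G ident x (t (Fintype.card V)) p T := by
        funext v
        exact (hresult _ lam N v).trans (if_neg h)
      push Not at h
      obtain ⟨hε2, hn⟩ := h
      refine ⟨2 * T + 1, ?_, ?_, ?_⟩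
      · have h1 : (T : ℝ) < 2 / ε + 1 := Nat.ceil_lt_add_one (by positivity)
        have h2 : 1 ≤ 1 / ε := by rw [le_div_iff₀ hε]; linarith
        have h3 : 1 / ε ≤ lam / ε ^ 2 := by
          rw [div_le_div_iff₀ hε (by positivity)]
          nlinarith
        have h4 := le_max_right 1 ((lam : ℝ) / ε ^ 2)
        have h5 : 2 / ε = 2 * (1 / ε) := by ring
        push_cast
        linarith
      · intro v
        rw [hout]
        simp [scheduleOutput]
      · rw [hout]
        have hp0 : 1 ≤ p := by
          by_contra hcon
          have h1 := (hp hε2).1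
          rw [show p = 0 by omega, pow_zero, div_le_one hε] at h1
          linarith
        refine (isApproxSchedule_inCover rfl hinj hα hβ hlam harb
          (isClustering_clusters N.cover_unionSet hG hinj hid
            (palette_logStar _ c (by omega)) p) hε ?_ (Nat.le_ceil _)).congr fun k hk =>
            coverOf_scheduleOutput G ident x _ p T k hk
        -- After `p` phases the minimum weight is 2^p / 2, a division of naturals that is exact for
        -- p ≥ 1; hence 2^p ≥ 8/ε provides the required 4/ε.
        obtain ⟨q, rfl⟩ : ∃ q, p = q + 1 := ⟨p - 1, by omega⟩
        have h1 := (hp hε2).1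
        rw [pow_succ, Nat.mul_div_cancel _ (by norm_num)]
        rw [pow_succ, show 8 / ε = 4 / ε * 2 by ring] at h1
        push_cast
        linarith
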